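/- **Definitions.** A $C^\infty$-ring is a set $\mathscr C$ with an operation $h_{\mathscr C}:\mathscr C^n\to\mathscr C$ for every $n\ge 0$ and every smooth $h:\mathbb R^n\to\mathbb R$, such that coordinate functions act as projections and $(g\circ(h_1,\dots,h_m))_{\mathscr C}=g_{\mathscr C}\circ((h_1)_{\mathscr C},\dots,(h_m)_{\mathscr C})$; a morphism is a map commuting with all the operations. Addition, multiplication and constants make $\mathscr C$ a commutative $\mathbb R$-algebra. A $C^\infty$-ringed space $(M,\mathscr A)$ is a topological space $M$ with a sheaf $\mathscr A$ of $C^\infty$-rings (in a local one all stalks are local; this is not needed here). A map $(f,f_\#):(M,\mathscr A)\to(N,\mathscr B)$ is a continuous map $f:M\to N$ with a map of sheaves of $C^\infty$-rings $f_\#:\mathscr B\to f_*\mathscr A$. For a $C^\infty$-ring $\mathscr C$ let $\Omega^1_{\mathscr C}$ be the module of $C^\infty$-Kähler differentials: the $\mathscr C$-module generated by symbols $d_{\mathscr C}c$, $c\in\mathscr C$, modulo the relations $d_{\mathscr C}(h_{\mathscr C}(c_1,\dots,c_n))=\sum_i(\partial_ih)_{\mathscr C}(c_1,\dots,c_n)\,d_{\mathscr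 C}c_i$ for all smooth $h:\mathbb R^n\to\mathbb R$. Let $\Lambda^\bullet\Omega^1_{\mathscr C}=\bigoplus_{k\ge0}\Lambda^k\Omega^1_{\mathscr C}$ be its exterior algebra over $\mathscr C$, and $d$ the degree $1$ derivation of it with $d\circ d=0$ and $da=d_{\mathscr C}a$ for $a\in\mathscr C$. A CDGA over $\mathscr C$ consists of $\mathscr C$-modules $\mathscr M^k$, $k\ge 0$, with associative graded-commutative $\mathscr C$-bilinear products $\wedge:\mathscr M^k\times\mathscr M^l\to\mathscr M^{k+l}$ and $\mathbb R$-linear maps $d:\mathscr M^k\to\mathscr M^{k+1}$ with $d\circ d=0$ and $d(x\wedge y)=dx\wedge y+(-1)^kx\wedge dy$ for $x\in\mathscr M^k$. A morphism from a CDGA over $\mathscr C$ to a CDGA over $\mathscr D$ is a morphism of $C^\infty$-rings $\varphi:\mathscr C\to\mathscr D$ together with additive maps in each degree that are $\varphi$-linear and commute with $\wedge$ and $d$. Then $\mathscr C\mapsto(\mathscr C,(\Lambda^\bullet\Omega^1_{\mathscr C},\wedge,d))$ is a functor, $\varphi$ acting by $\Lambda^\bullet\varphi:\ a\,db_1\wedge\dots\wedge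 db_k\mapsto\varphi(a)\,d\varphi(b_1)\wedge\dots\wedge d\varphi(b_k)$. A (pre)sheaf of CDGAs on a space is a presheaf of such pairs (a $C^\infty$-ring, a CDGA over it) — for a sheaf, the presheaf of rings and the presheaf of elements of each degree have to be sheaves. For a $C^\infty$-ringed space $(M,\mathscr A)$ let $\Lambda^\bullet\Omega^1_{\mathscr A}$ be the presheaf $U\mapsto\Lambda^\bullet\Omega^1_{\mathscr A(U)}$ of CDGAs over $\mathscr A$, and let $\boldsymbol\Omega^\bullet_{\mathscr A}$ be its sheafification, formed degree by degree, with the induced module structure over $\mathscr A$, product $\wedge$ and differential $d$. Let $\eta_{\mathscr A}:\Lambda^\bullet\Omega^1_{\mathscr A}\to\boldsymbol\Omega^\bullet_{\mathscr A}$ be the canonical map. **Theorem.** Let $(f,f_\#):(M,\mathscr A)\to(N,\mathscr B)$ be a map of $C^\infty$-ringed spaces, and let $\tilde f:\Lambda^\bullet\Omega^1_{\mathscr B}\to f_*(\Lambda^\bullet\Omega^1_{\mathscr A})$ be the map of presheaves of CDGAs given on an open set $U\subseteq N$ by $\Lambda^\bullet(f_\#)_U:\Lambda^\bullet\Omega^1_{\mathscr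 B(U)}\to\Lambda^\bullet\Omega^1_{\mathscr A(f^{-1}U)}$. Then there is a unique morphism of sheaves of CDGAs $$\bar f:\boldsymbol\Omega^\bullet_{\mathscr B}\to f_*(\boldsymbol\Omega^\bullet_{\mathscr A})$$ over $f_\#:\mathscr B\to f_*\mathscr A$ (so $\bar f$ commutes with restrictions, is linear along $f_\#$, and is compatible with the wedge product and with the exterior derivative) such that $\bar f\circ\eta_{\mathscr B}=f_*(\eta_{\mathscr A})\circ\tilde f$. -/

import Mathlib

open CategoryTheory TopologicalSpace Opposite
open scoped ContDiff

universe u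

noncomputable section

/-- Smooth functions `ℝⁿ → ℝ`. -/
def SmoothFun (n : ℕ) : Type :=
  {f : (Fin n → ℝ) → ℝ // ContDiff ℝ ∞ f}

namespace SmoothFun

variable {n m : ℕ}

instance : CoeFun (SmoothFun n) (fun _ => (Fin n → ℝ) → ℝ) := ⟨Subtype.val⟩

@[ext]
theorem ext {f g : SmoothFun n} (h : ∀ x, f x = g x) : f = g :=
  Subtype.ext (funext h)

/-- The `i`-th coordinate function. -/
def proj (i : Fin n) : SmoothFun n := ⟨fun x => x i, contDiff_apply ℝ ℝ i⟩

/-- Composition `g ∘ (f₁, …, f_m)`. -/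
def comp (g : SmoothFun m) (f : Fin m → SmoothFun n) : SmoothFun n :=
  ⟨fun x => g (fun j => f j x), g.2.comp (contDiff_pi.2 fun j => (f j).2)⟩

/-- The partial derivative `∂ᵢ f`. -/
def partialDeriv (i : Fin n) (f : SmoothFun n) : SmoothFun n :=
  ⟨fun x => fderiv ℝ f.1 x (Pi.single i 1),
    (f.2.fderiv_right (m := ∞) (by simp)).clm_apply contDiff_const⟩

/-- A constant function. -/
def const (n : ℕ) (r : ℝ) : SmoothFun n := ⟨fun _ => r, contDiff_const⟩

instance : Add (SmoothFun n) := ⟨fun f g => ⟨fun x => f x + g x, f.2.add g.2⟩⟩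
instance : Mul (SmoothFun n) := ⟨fun f g => ⟨fun x => f x * g x, f.2.mul g.2⟩⟩
instance : Neg (SmoothFun n) := ⟨fun f => ⟨fun x => -f x, f.2.neg⟩⟩

@[simp] theorem proj_apply (i : Fin n) (x : Fin n → ℝ) : proj i x = x i := rfl
@[simp] theorem const_apply (r : ℝ) (x : Fin n → ℝ) : const n r x = r := rfl
@[simp] theorem add_apply (f g : SmoothFun n) (x : Fin n → ℝ) : (f + g) x = f x + g x := rfl
@[simp] theorem mul_apply (f g : SmoothFun n) (x : Fin n → ℝ) : (f * g) x = f x * g x := rfl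
@[simp] theorem neg_apply (f : SmoothFun n) (x : Fin n → ℝ) : (-f) x = -f x := rfl

theorem partialDeriv_comm (i j : Fin n) (f : SmoothFun n) :
    partialDeriv i (partialDeriv j f) = partialDeriv j (partialDeriv i f) := by
  have key : ∀ (a b : Fin n) (x : Fin n → ℝ), partialDeriv a (partialDeriv b f) x
      = fderiv ℝ (fderiv ℝ f.1) x (Pi.single a 1) (Pi.single b 1) := by
    intro a b x
    have hd : DifferentiableAt ℝ (fderiv ℝ f.1) x :=
      ((f.2.fderiv_right (m := ∞) (by simp)).differentiable (by simp)) x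
    change fderiv ℝ (fun y => fderiv ℝ f.1 y (Pi.single b 1)) x (Pi.single a 1) = _
    rw [fderiv_clm_apply hd (differentiableAt_const _)]
    simp
  ext x
  rw [key, key]
  have hs : IsSymmSndFDerivAt ℝ f.1 x :=
    f.2.contDiffAt.isSymmSndFDerivAt (by
      rw [minSmoothness_of_isRCLikeNormedField]
      exact WithTop.coe_le_coe.2 (le_top : (2 : ℕ∞) ≤ ⊤))
  exact hs _ _

theorem partialDeriv_add (i : Fin n) (f g : SmoothFun n) :
    partialDeriv i (f + g) = partialDeriv i f + partialDeriv i g := by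
  ext x
  have hf : DifferentiableAt ℝ f.1 x := (f.2.differentiable (by simp)) x
  have hg : DifferentiableAt ℝ g.1 x := (g.2.differentiable (by simp)) x
  change fderiv ℝ (fun y => f.1 y + g.1 y) x (Pi.single i 1) = _
  rw [fderiv_fun_add hf hg]
  rfl

theorem partialDeriv_mul (i : Fin n) (f g : SmoothFun n) :
    partialDeriv i (f * g) = f * partialDeriv i g + g * partialDeriv i f := by
  ext x
  have hf : DifferentiableAt ℝ f.1 x := (f.2.differentiable (by simp)) x
  have hg : DifferentiableAt ℝ g.1 x := (g.2.differentiable (by simp)) x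
  change fderiv ℝ (fun y => f.1 y * g.1 y) x (Pi.single i 1) = _
  rw [fderiv_fun_mul hf hg]
  rfl

theorem partialDeriv_const (i : Fin n) (r : ℝ) :
    partialDeriv i (const n r) = const n 0 := by
  ext x
  simp [partialDeriv, const]

theorem partialDeriv_proj (i j : Fin n) :
    partialDeriv i (proj j) = const n (if i = j then 1 else 0) := by
  ext x
  change fderiv ℝ (fun y : Fin n → ℝ => y j) x (Pi.single i 1) = _
  rw [(hasFDerivAt_apply j x).fderiv]
  simp [Pi.single_apply, eq_comm]

end SmoothFun

/-- A `C^∞`-ring: a set with an `n`-ary operation for every smooth function `ℝⁿ → ℝ`, such that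
coordinate functions act as projections and compositions act as compositions. -/
class CInftyRing (C : Type u) where
  op : ∀ {n : ℕ}, SmoothFun n → (Fin n → C) → C
  op_proj : ∀ {n : ℕ} (i : Fin n) (c : Fin n → C), op (SmoothFun.proj i) c = c i
  op_comp : ∀ {n m : ℕ} (g : SmoothFun m) (f : Fin m → SmoothFun n) (c : Fin n → C),
    op (g.comp f) c = op g (fun j => op (f j) c)

namespace CInftyRing

variable {C : Type u} [CInftyRing C]

/-- The constant of a `C^∞`-ring given by a `0`-ary operation. -/
def const (C : Type u) [CInftyRing C] (r : ℝ) : C := op (SmoothFun.const 0 r) Fin.elim0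

instance : Add C := ⟨fun a b => op (SmoothFun.proj 0 + SmoothFun.proj 1 : SmoothFun 2) ![a, b]⟩
instance : Mul C := ⟨fun a b => op (SmoothFun.proj 0 * SmoothFun.proj 1 : SmoothFun 2) ![a, b]⟩
instance : Neg C := ⟨fun a => op (-SmoothFun.proj 0 : SmoothFun 1) ![a]⟩
instance : Zero C := ⟨const C 0⟩
instance : One C := ⟨const C 1⟩

theorem op_add {n : ℕ} (f g : SmoothFun n) (c : Fin n → C) :
    op (f + g) c = op f c + op g c := by
  have h : f + g = (SmoothFun.proj 0 + SmoothFun.proj 1 : SmoothFun 2).comp ![f, g] := by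
    ext x; rfl
  rw [h, op_comp]
  change _ = op _ _
  congr 1
  funext j
  fin_cases j <;> rfl

theorem op_mul {n : ℕ} (f g : SmoothFun n) (c : Fin n → C) :
    op (f * g) c = op f c * op g c := by
  have h : f * g = (SmoothFun.proj 0 * SmoothFun.proj 1 : SmoothFun 2).comp ![f, g] := by
    ext x; rfl
  rw [h, op_comp]
  change _ = op _ _
  congr 1
  funext j
  fin_cases j <;> rfl

theorem op_neg {n : ℕ} (f : SmoothFun n) (c : Fin n → C) :
    op (-f) c = -op f c := by
  have h : -f = (-SmoothFun.proj 0 : SmoothFun 1).comp ![f] := by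
    ext x; rfl
  rw [h, op_comp]
  change _ = op _ _
  congr 1
  funext j
  fin_cases j; rfl

theorem op_const {n : ℕ} (r : ℝ) (c : Fin n → C) :
    op (SmoothFun.const n r) c = const C r := by
  have h : SmoothFun.const n r = (SmoothFun.const 0 r).comp (fun i : Fin 0 => i.elim0) := by
    ext x; rfl
  rw [h, op_comp]
  unfold const
  congr 1
  funext j
  exact j.elim0

/-- The commutative ring underlying a `C^∞`-ring. -/
instance toCommRing : CommRing C where
  add_assoc a b c := by
    have h := congrArg (fun f => op f ![a, b, c]) (show
      (SmoothFun.proj 0 + SmoothFun.proj 1 + SmoothFun.proj 2 : SmoothFun 3)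
        = SmoothFun.proj 0 + (SmoothFun.proj 1 + SmoothFun.proj 2) by ext x; simp; ring)
    simp only [op_add, op_proj] at h
    exact h
  zero_add a := by
    have h := congrArg (fun f => op f ![a]) (show
      (SmoothFun.const 1 0 + SmoothFun.proj 0 : SmoothFun 1) = SmoothFun.proj 0 by ext x; simp)
    simp only [op_add, op_proj, op_const] at h
    exact h
  add_zero a := by
    have h := congrArg (fun f => op f ![a]) (show
      (SmoothFun.proj 0 + SmoothFun.const 1 0 : SmoothFun 1) = SmoothFun.proj 0 by ext x; simp)
    simp only [op_add, op_proj, op_const] at h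
    exact h
  nsmul := nsmulRec
  zsmul := zsmulRec
  neg_add_cancel a := by
    have h := congrArg (fun f => op f ![a]) (show
      (-SmoothFun.proj 0 + SmoothFun.proj 0 : SmoothFun 1) = SmoothFun.const 1 0 by ext x; simp)
    simp only [op_add, op_neg, op_proj, op_const] at h
    exact h
  add_comm a b := by
    have h := congrArg (fun f => op f ![a, b]) (show
      (SmoothFun.proj 0 + SmoothFun.proj 1 : SmoothFun 2)
        = SmoothFun.proj 1 + SmoothFun.proj 0 by ext x; simp; ring)
    simp only [op_add, op_proj] at h
    exact h
  left_distrib a b c := by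
    have h := congrArg (fun f => op f ![a, b, c]) (show
      (SmoothFun.proj 0 * (SmoothFun.proj 1 + SmoothFun.proj 2) : SmoothFun 3)
        = SmoothFun.proj 0 * SmoothFun.proj 1 + SmoothFun.proj 0 * SmoothFun.proj 2 by
          ext x; simp; ring)
    simp only [op_add, op_mul, op_proj] at h
    exact h
  right_distrib a b c := by
    have h := congrArg (fun f => op f ![a, b, c]) (show
      ((SmoothFun.proj 0 + SmoothFun.proj 1) * SmoothFun.proj 2 : SmoothFun 3)
        = SmoothFun.proj 0 * SmoothFun.proj 2 + SmoothFun.proj 1 * SmoothFun.proj 2 by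
          ext x; simp; ring)
    simp only [op_add, op_mul, op_proj] at h
    exact h
  zero_mul a := by
    have h := congrArg (fun f => op f ![a]) (show
      (SmoothFun.const 1 0 * SmoothFun.proj 0 : SmoothFun 1) = SmoothFun.const 1 0 by ext x; simp)
    simp only [op_mul, op_proj, op_const] at h
    exact h
  mul_zero a := by
    have h := congrArg (fun f => op f ![a]) (show
      (SmoothFun.proj 0 * SmoothFun.const 1 0 : SmoothFun 1) = SmoothFun.const 1 0 by ext x; simp)
    simp only [op_mul, op_proj, op_const] at h
    exact h
  mul_assoc a b c := by
    have h := congrArg (fun f => op f ![a, b, c]) (show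
      (SmoothFun.proj 0 * SmoothFun.proj 1 * SmoothFun.proj 2 : SmoothFun 3)
        = SmoothFun.proj 0 * (SmoothFun.proj 1 * SmoothFun.proj 2) by ext x; simp; ring)
    simp only [op_mul, op_proj] at h
    exact h
  one_mul a := by
    have h := congrArg (fun f => op f ![a]) (show
      (SmoothFun.const 1 1 * SmoothFun.proj 0 : SmoothFun 1) = SmoothFun.proj 0 by ext x; simp)
    simp only [op_mul, op_proj, op_const] at h
    exact h
  mul_one a := by
    have h := congrArg (fun f => op f ![a]) (show
      (SmoothFun.proj 0 * SmoothFun.const 1 1 : SmoothFun 1) = SmoothFun.proj 0 by ext x; simp)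
    simp only [op_mul, op_proj, op_const] at h
    exact h
  mul_comm a b := by
    have h := congrArg (fun f => op f ![a, b]) (show
      (SmoothFun.proj 0 * SmoothFun.proj 1 : SmoothFun 2)
        = SmoothFun.proj 1 * SmoothFun.proj 0 by ext x; simp; ring)
    simp only [op_mul, op_proj] at h
    exact h

theorem const_zero : const C 0 = 0 := rfl
theorem const_one : const C 1 = 1 := rfl

/-- A morphism of `C^∞`-rings: a map preserving all the operations. -/
@[ext]
structure Hom (C D : Type u) [CInftyRing C] [CInftyRing D] where
  toFun : C → D
  map_op : ∀ {n : ℕ} (f : SmoothFun n) (c : Fin n → C),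
    toFun (op f c) = op f (fun i => toFun (c i))

variable {D : Type u} [CInftyRing D]

theorem Hom.map_const (φ : Hom C D) (r : ℝ) : φ.toFun (const C r) = const D r := by
  unfold const
  rw [φ.map_op]
  congr 1
  funext j
  exact j.elim0

/-- The ring homomorphism underlying a morphism of `C^∞`-rings. -/
def Hom.toRingHom (φ : Hom C D) : C →+* D where
  toFun := φ.toFun
  map_zero' := φ.map_const 0
  map_one' := φ.map_const 1
  map_add' a b := by
    change φ.toFun (op _ _) = op _ _
    rw [φ.map_op]
    congr 1
    funext j
    fin_cases j <;> rfl
  map_mul' a b := by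
    change φ.toFun (op _ _) = op _ _
    rw [φ.map_op]
    congr 1
    funext j
    fin_cases j <;> rfl

@[simp] theorem Hom.toRingHom_apply (φ : Hom C D) (c : C) : φ.toRingHom c = φ.toFun c := rfl

/-- A `C^∞`-derivation of `C` with values in a `C`-module. -/
def IsDerivation {N : Type*} [AddCommGroup N] [Module C N] (X : C → N) : Prop :=
  ∀ (n : ℕ) (f : SmoothFun n) (a : Fin n → C),
    X (op f a) = ∑ i, op (f.partialDeriv i) a • X (a i)

section Derivation

variable {N : Type*} [AddCommGroup N] [Module C N] {X : C → N}

theorem IsDerivation.map_add (hX : IsDerivation X) (a b : C) : X (a + b) = X a + X b := by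
  have h := hX _ (SmoothFun.proj 0 + SmoothFun.proj 1 : SmoothFun 2) ![a, b]
  simpa [op_add, op_proj, SmoothFun.partialDeriv_add, SmoothFun.partialDeriv_proj, op_const,
    const_zero, const_one] using h

theorem IsDerivation.map_mul (hX : IsDerivation X) (a b : C) :
    X (a * b) = a • X b + b • X a := by
  have h := hX _ (SmoothFun.proj 0 * SmoothFun.proj 1 : SmoothFun 2) ![a, b]
  rw [op_mul, op_proj, op_proj, Fin.sum_univ_two] at h
  simpa [op_add, op_mul, op_proj, SmoothFun.partialDeriv_mul, SmoothFun.partialDeriv_proj,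
    op_const, const_zero, const_one, add_comm] using h

theorem IsDerivation.map_const (hX : IsDerivation X) (r : ℝ) : X (const C r) = 0 := by
  have h := hX _ (SmoothFun.const 0 r) Fin.elim0
  simp only [Finset.univ_eq_empty, Finset.sum_empty] at h
  exact h

end Derivation

/-! ### Kähler differentials -/

variable (C) in
/-- The submodule of relations in the free module on the symbols `d̂ b`, `b ∈ C`. -/
def kaehlerRelations : Submodule C (C →₀ C) :=
  Submodule.span C {z | ∃ (n : ℕ) (f : SmoothFun n) (a : Fin n → C),
    z = Finsupp.single (op f a) 1
      - ∑ i, op (f.partialDeriv i) a • Finsupp.single (a i) (1 : C)}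

variable (C) in
/-- The module `Ω¹_C` of `C^∞`-Kähler differentials. -/
abbrev Kaehler : Type u := (C →₀ C) ⧸ kaehlerRelations C

/-- The universal `C^∞`-derivation `d_C : C → Ω¹_C`. -/
def kaehlerD (c : C) : Kaehler C := (kaehlerRelations C).mkQ (Finsupp.single c 1)

theorem kaehlerD_isDerivation : IsDerivation (kaehlerD (C := C)) := by
  intro n f a
  have h : Finsupp.single (op f a) 1
      - ∑ i, op (f.partialDeriv i) a • Finsupp.single (a i) (1 : C) ∈ kaehlerRelations C :=
    Submodule.subset_span ⟨n, f, a, rfl⟩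
  rw [← Submodule.ker_mkQ (kaehlerRelations C), LinearMap.mem_ker, map_sub, sub_eq_zero,
    map_sum] at h
  simp only [map_smul] at h
  exact h

/-- The linear map `Ω¹_C → N` induced by a `C^∞`-derivation `C → N`. -/
def kaehlerLift {N : Type*} [AddCommGroup N] [Module C N] (X : C → N) (hX : IsDerivation X) :
    Kaehler C →ₗ[C] N :=
  (kaehlerRelations C).liftQ (Finsupp.linearCombination C X) (by
    refine Submodule.span_le.2 ?_
    rintro _ ⟨n, f, a, rfl⟩
    simp [hX n f a])

@[simp] theorem kaehlerLift_d {N : Type*} [AddCommGroup N] [Module C N] (X : C → N)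
    (hX : IsDerivation X) (c : C) : kaehlerLift X hX (kaehlerD c) = X c := by
  refine ((kaehlerRelations C).liftQ_apply _ _).trans ?_
  rw [Finsupp.linearCombination_single, one_smul]

theorem kaehler_induction {p : Kaehler C → Prop} (h0 : p 0) (hadd : ∀ x y, p x → p y → p (x + y))
    (hd : ∀ a b : C, p (a • kaehlerD b)) (x : Kaehler C) : p x := by
  obtain ⟨y, rfl⟩ := (kaehlerRelations C).mkQ_surjective x
  induction y using Finsupp.induction_linear with
  | zero => simpa using h0
  | add f g hf hg => rw [map_add]; exact hadd _ _ hf hg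
  | single b a =>
    have := hd a b
    rwa [kaehlerD, ← map_smul, Finsupp.smul_single, smul_eq_mul, mul_one] at this

end CInftyRing

namespace CInftyRing

/-! ### The `C^∞`-algebraic de Rham complex of a `C^∞`-ring -/

variable {C : Type u} [CInftyRing C]

variable (C) in
/-- The exterior algebra of `Ω¹_C` over `C`. -/
abbrev Forms : Type u := ExteriorAlgebra C (Kaehler C)

/-- `d b`, as an element of the exterior algebra. -/
def dForm (b : C) : Forms C := ExteriorAlgebra.ι C (kaehlerD b)

theorem forms_induction {p : Forms C → Prop} (halg : ∀ a, p (algebraMap C (Forms C) a))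
    (hd : ∀ b, p (dForm b)) (hmul : ∀ x y, p x → p y → p (x * y))
    (hadd : ∀ x y, p x → p y → p (x + y)) (x : Forms C) : p x := by
  induction x using ExteriorAlgebra.induction with
  | algebraMap r => exact halg r
  | ι e =>
    induction e using kaehler_induction with
    | h0 => simpa using halg 0
    | hadd x y hx hy => rw [map_add]; exact hadd _ _ hx hy
    | hd a b =>
      rw [map_smul, Algebra.smul_def]
      exact hmul _ _ (halg a) (hd b)
  | mul x y hx hy => exact hmul x y hx hy
  | add x y hx hy => exact hadd x y hx hy

/-- The involution acting by `(-1)^k` on forms of degree `k`. -/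
def signInv : Forms C →ₐ[C] Forms C := ExteriorAlgebra.map (-LinearMap.id)

@[simp] theorem signInv_dForm (b : C) : signInv (dForm b) = -dForm b := by
  simp [signInv, dForm]

theorem dForm_mul (b : C) (x : Forms C) : dForm b * x = signInv x * dForm b := by
  induction x using forms_induction with
  | halg a => rw [AlgHom.commutes, Algebra.commutes]
  | hd c =>
    rw [signInv_dForm, neg_mul, eq_neg_iff_add_eq_zero]
    exact ExteriorAlgebra.ι_add_mul_swap _ _
  | hmul x y hx hy => rw [map_mul, ← mul_assoc, hx, mul_assoc, hy, mul_assoc]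
  | hadd x y hx hy => rw [map_add, mul_add, add_mul, hx, hy]

theorem signInv_signInv (x : Forms C) : signInv (signInv x) = x := by
  induction x using forms_induction with
  | halg a => simp
  | hd c => simp
  | hmul x y hx hy => simp [hx, hy]
  | hadd x y hx hy => simp [hx, hy]

variable (C) in
/-- Pairs `(x, y)` of elements of the exterior algebra with the product
`(x, y) (x', y') = (x x', x̂ y' + y x')`, where `x̂` is `signInv x`. A ring homomorphism `x ↦ (x, D x)`
into this ring is the same as a graded derivation `D` of the exterior algebra. -/
@[ext]
structure TwistedPairs : Type u where
  fst : Forms C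
  snd : Forms C

namespace TwistedPairs

instance : Add (TwistedPairs C) := ⟨fun p q => ⟨p.fst + q.fst, p.snd + q.snd⟩⟩
instance : Neg (TwistedPairs C) := ⟨fun p => ⟨-p.fst, -p.snd⟩⟩
instance : Zero (TwistedPairs C) := ⟨⟨0, 0⟩⟩
instance : One (TwistedPairs C) := ⟨⟨1, 0⟩⟩
instance : Mul (TwistedPairs C) :=
  ⟨fun p q => ⟨p.fst * q.fst, signInv p.fst * q.snd + p.snd * q.fst⟩⟩

@[simp] theorem add_fst (p q : TwistedPairs C) : (p + q).fst = p.fst + q.fst := rfl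
@[simp] theorem add_snd (p q : TwistedPairs C) : (p + q).snd = p.snd + q.snd := rfl
@[simp] theorem neg_fst (p : TwistedPairs C) : (-p).fst = -p.fst := rfl
@[simp] theorem neg_snd (p : TwistedPairs C) : (-p).snd = -p.snd := rfl
@[simp] theorem zero_fst : (0 : TwistedPairs C).fst = 0 := rfl
@[simp] theorem zero_snd : (0 : TwistedPairs C).snd = 0 := rfl
@[simp] theorem one_fst : (1 : TwistedPairs C).fst = 1 := rfl
@[simp] theorem one_snd : (1 : TwistedPairs C).snd = 0 := rfl
@[simp] theorem mul_fst (p q : TwistedPairs C) : (p * q).fst = p.fst * q.fst := rfl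
@[simp] theorem mul_snd (p q : TwistedPairs C) :
    (p * q).snd = signInv p.fst * q.snd + p.snd * q.fst := rfl

instance : Ring (TwistedPairs C) where
  add_assoc p q r := by ext <;> simp [add_assoc]
  zero_add p := by ext <;> simp
  add_zero p := by ext <;> simp
  add_comm p q := by ext <;> simp [add_comm]
  nsmul := nsmulRec
  zsmul := zsmulRec
  neg_add_cancel p := by ext <;> simp
  left_distrib p q r := by ext <;> simp <;> noncomm_ring
  right_distrib p q r := by ext <;> simp <;> noncomm_ring
  zero_mul p := by ext <;> simp
  mul_zero p := by ext <;> simp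
  mul_assoc p q r := by ext <;> simp <;> noncomm_ring
  one_mul p := by ext <;> simp
  mul_one p := by ext <;> simp

variable (C) in
/-- The first projection. -/
def fstHom : TwistedPairs C →+ Forms C := ⟨⟨fst, rfl⟩, fun _ _ => rfl⟩

variable (C) in
/-- The second projection. -/
def sndHom : TwistedPairs C →+ Forms C := ⟨⟨snd, rfl⟩, fun _ _ => rfl⟩

variable (C) in
/-- The ring homomorphism `a ↦ (a, d a)`. -/
def scalar : C →+* TwistedPairs C where
  toFun a := ⟨algebraMap C (Forms C) a, dForm a⟩
  map_one' := by
    ext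
    · simp
    · rw [one_snd, ← const_one, dForm, kaehlerD_isDerivation.map_const, map_zero]
  map_zero' := by
    ext
    · simp
    · rw [zero_snd, ← const_zero, dForm, kaehlerD_isDerivation.map_const, map_zero]
  map_add' a b := by
    ext
    · simp
    · change dForm (a + b) = dForm a + dForm b
      simp only [dForm, kaehlerD_isDerivation.map_add, map_add]
  map_mul' a b := by
    ext
    · simp
    · rw [mul_snd, dForm, kaehlerD_isDerivation.map_mul, map_add, map_smul, map_smul,
        AlgHom.commutes, Algebra.smul_def, Algebra.smul_def, Algebra.commutes b]; rfl

instance : Algebra C (TwistedPairs C) := RingHom.toAlgebra' (scalar C) (by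
  intro a p
  ext
  · exact Algebra.commutes _ _
  · rw [mul_snd, mul_snd]
    change signInv (algebraMap C _ a) * p.snd + dForm a * p.fst
      = signInv p.fst * dForm a + p.snd * algebraMap C _ a
    rw [dForm_mul, AlgHom.commutes, Algebra.commutes, add_comm])

theorem smul_fst (a : C) (p : TwistedPairs C) :
    (a • p).fst = algebraMap C _ a * p.fst := by
  rw [Algebra.smul_def]; rfl

theorem smul_snd (a : C) (p : TwistedPairs C) :
    (a • p).snd = algebraMap C _ a * p.snd + dForm a * p.fst := by
  rw [Algebra.smul_def]
  change signInv (algebraMap C _ a) * p.snd + dForm a * p.fst = _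
  rw [AlgHom.commutes]

theorem derivation_aux :
    IsDerivation (C := C) (N := TwistedPairs C) (fun b => ⟨dForm b, 0⟩) := by
  intro n f a
  have hexp : ∀ g : SmoothFun n, dForm (op g a)
      = ∑ i, algebraMap C (Forms C) (op (g.partialDeriv i) a) * dForm (a i) := by
    intro g
    rw [dForm, kaehlerD_isDerivation n g a, map_sum]
    refine Finset.sum_congr rfl fun i _ => ?_
    rw [map_smul, Algebra.smul_def]; rfl
  ext
  · change dForm (op f a) = fstHom C (∑ i, op (f.partialDeriv i) a • ⟨dForm (a i), 0⟩)
    rw [map_sum, hexp f]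
    refine Finset.sum_congr rfl fun i _ => ?_
    exact (smul_fst (op (f.partialDeriv i) a) (⟨dForm (a i), 0⟩ : TwistedPairs C)).symm
  · change (0 : Forms C) = sndHom C (∑ i, op (f.partialDeriv i) a • ⟨dForm (a i), 0⟩)
    rw [map_sum]
    have hsm : ∀ i, sndHom C (op (f.partialDeriv i) a • (⟨dForm (a i), 0⟩ : TwistedPairs C))
        = dForm (op (f.partialDeriv i) a) * dForm (a i) := by
      intro i
      refine (smul_snd _ _).trans ?_
      simp
    simp only [hsm]
    set S : Forms C := ∑ i, dForm (op (f.partialDeriv i) a) * dForm (a i) with hS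
    have h1 : S = ∑ i, ∑ j, algebraMap C (Forms C) (op ((f.partialDeriv i).partialDeriv j) a)
        * (dForm (a j) * dForm (a i)) := by
      rw [hS]
      refine Finset.sum_congr rfl fun i _ => ?_
      rw [hexp, Finset.sum_mul]
      exact Finset.sum_congr rfl fun j _ => mul_assoc _ _ _
    have h2 : S = -S := by
      conv_lhs => rw [h1, Finset.sum_comm]
      rw [h1, ← Finset.sum_neg_distrib]
      refine Finset.sum_congr rfl fun i _ => ?_
      rw [← Finset.sum_neg_distrib]
      refine Finset.sum_congr rfl fun j _ => ?_
      rw [SmoothFun.partialDeriv_comm, dForm_mul (a i), signInv_dForm, neg_mul, mul_neg]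
    have h3 : (const C 2) • S = 0 := by
      have : const C 2 = 1 + 1 := by
        have h := op_add (SmoothFun.const 0 1) (SmoothFun.const 0 1) (Fin.elim0 : Fin 0 → C)
        have e : SmoothFun.const 0 1 + SmoothFun.const 0 1 = SmoothFun.const 0 2 := by
          ext x; simp; norm_num
        rw [e] at h
        exact h
      rw [this, add_smul, one_smul]
      nth_rewrite 2 [h2]
      exact add_neg_cancel S
    have h4 : const C (1 / 2) * const C 2 = 1 := by
      have h := op_mul (SmoothFun.const 0 (1 / 2)) (SmoothFun.const 0 2) (Fin.elim0 : Fin 0 → C)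
      have e : SmoothFun.const 0 (1 / 2) * SmoothFun.const 0 2 = SmoothFun.const 0 1 := by
        ext x; simp
      rw [e] at h
      exact h.symm
    have h5 := congrArg (fun z => const C (1 / 2) • z) h3
    simp only [smul_smul, h4, one_smul, smul_zero] at h5
    exact h5.symm

end TwistedPairs

/-- The algebra homomorphism `x ↦ (x, d x)`. -/
def extDerivHom : Forms C →ₐ[C] TwistedPairs C :=
  ExteriorAlgebra.lift C ⟨kaehlerLift _ TwistedPairs.derivation_aux, by
    have h0 : ∀ b c : C, (⟨dForm b, 0⟩ * ⟨dForm c, 0⟩ : TwistedPairs C)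
        = ⟨dForm b * dForm c, 0⟩ := by
      intro b c
      ext <;> simp
    have hz : ∀ x y, kaehlerLift _ TwistedPairs.derivation_aux x
        * kaehlerLift _ TwistedPairs.derivation_aux y
        + kaehlerLift _ TwistedPairs.derivation_aux y
        * kaehlerLift _ TwistedPairs.derivation_aux x = (0 : TwistedPairs C) := by
      intro x y
      induction x using kaehler_induction with
      | h0 => simp
      | hadd x x' hx hx' =>
        rw [map_add, add_mul, mul_add, add_add_add_comm, hx, hx', add_zero]
      | hd a b =>
        induction y using kaehler_induction with
        | h0 => simp
        | hadd x x' hx hx' =>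
          rw [map_add, add_mul, mul_add, add_add_add_comm, hx, hx', add_zero]
        | hd a' b' =>
          simp only [map_smul, kaehlerLift_d, smul_mul_assoc, mul_smul_comm]
          rw [smul_comm a' a, ← smul_add, ← smul_add, h0, h0]
          have hs : (⟨dForm b * dForm b', 0⟩ + ⟨dForm b' * dForm b, 0⟩ : TwistedPairs C) = 0 :=
            TwistedPairs.ext (ExteriorAlgebra.ι_add_mul_swap _ _) (add_zero _)
          rw [hs, smul_zero, smul_zero]
    intro x
    induction x using kaehler_induction with
    | h0 => simp
    | hadd x y hx hy =>
      rw [map_add, add_mul, mul_add, mul_add, hx, hy, zero_add, add_zero]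
      exact hz x y
    | hd a b =>
      simp only [map_smul, kaehlerLift_d, smul_mul_assoc, mul_smul_comm]
      rw [h0]
      have hs : (⟨dForm b * dForm b, 0⟩ : TwistedPairs C) = 0 :=
        TwistedPairs.ext (ExteriorAlgebra.ι_sq_zero _) rfl
      rw [hs, smul_zero, smul_zero]⟩

theorem extDerivHom_dForm (b : C) :
    extDerivHom (dForm b) = ⟨dForm b, 0⟩ := by
  rw [extDerivHom, dForm, ExteriorAlgebra.lift_ι_apply, kaehlerLift_d]; rfl

theorem extDerivHom_algebraMap (a : C) :
    extDerivHom (algebraMap C (Forms C) a) = ⟨algebraMap C (Forms C) a, dForm a⟩ := by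
  rw [AlgHom.commutes]; rfl

theorem extDerivHom_fst (x : Forms C) : (extDerivHom x).fst = x := by
  induction x using forms_induction with
  | halg a => rw [extDerivHom_algebraMap]
  | hd c => rw [extDerivHom_dForm]
  | hmul x y hx hy => rw [map_mul, TwistedPairs.mul_fst, hx, hy]
  | hadd x y hx hy => rw [map_add, TwistedPairs.add_fst, hx, hy]

variable (C) in
/-- The exterior derivative on the exterior algebra of `Ω¹_C`: the unique additive map with
`d a = d_C a` and `d (d_C a) = 0` for `a ∈ C` and `d (x ∧ y) = d x ∧ y + x̂ ∧ d y`, where `x̂` is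
`(-1)^k x` for `x` of degree `k`. -/
def extDeriv : Forms C →+ Forms C :=
  (TwistedPairs.sndHom C).comp
    (extDerivHom.toRingHom.toAddMonoidHom : Forms C →+ TwistedPairs C)

theorem extDeriv_apply (x : Forms C) : extDeriv C x = (extDerivHom x).snd := rfl

theorem extDeriv_algebraMap (a : C) : extDeriv C (algebraMap C (Forms C) a) = dForm a := by
  rw [extDeriv_apply, extDerivHom_algebraMap]

theorem extDeriv_dForm (b : C) : extDeriv C (dForm b) = 0 := by
  rw [extDeriv_apply, extDerivHom_dForm]

theorem extDeriv_mul (x y : Forms C) :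
    extDeriv C (x * y) = extDeriv C x * y + signInv x * extDeriv C y := by
  simp only [extDeriv_apply]
  rw [map_mul, TwistedPairs.mul_snd, extDerivHom_fst, extDerivHom_fst, add_comm]

theorem extDeriv_const_smul (r : ℝ) (x : Forms C) :
    extDeriv C (const C r • x) = const C r • extDeriv C x := by
  rw [Algebra.smul_def, extDeriv_mul, extDeriv_algebraMap, dForm,
    kaehlerD_isDerivation.map_const, map_zero, zero_mul, zero_add, AlgHom.commutes,
    Algebra.smul_def]

theorem extDeriv_signInv (x : Forms C) : extDeriv C (signInv x) = -signInv (extDeriv C x) := by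
  induction x using forms_induction with
  | halg a => rw [AlgHom.commutes, extDeriv_algebraMap, signInv_dForm, neg_neg]
  | hd c => simp [extDeriv_dForm]
  | hmul x y hx hy =>
    rw [map_mul, extDeriv_mul, extDeriv_mul, hx, hy, map_add, map_mul, map_mul]
    noncomm_ring
  | hadd x y hx hy => rw [map_add, map_add, hx, hy, map_add, map_add, neg_add]

theorem extDeriv_extDeriv (x : Forms C) : extDeriv C (extDeriv C x) = 0 := by
  induction x using forms_induction with
  | halg a => rw [extDeriv_algebraMap, extDeriv_dForm]
  | hd c => rw [extDeriv_dForm, map_zero]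
  | hmul x y hx hy =>
    rw [extDeriv_mul, map_add, extDeriv_mul, extDeriv_mul, hx, hy, extDeriv_signInv]
    simp
  | hadd x y hx hy => rw [map_add, map_add, hx, hy, add_zero]

theorem forms_degree_induction {p : ℕ → Forms C → Prop}
    (halg : ∀ a, p 0 (algebraMap C (Forms C) a))
    (hadd : ∀ k x y, p k x → p k y → p k (x + y))
    (hmul : ∀ k a b x, x ∈ ⋀[C]^k (Kaehler C) → p k x →
      p (k + 1) (algebraMap C (Forms C) a * (dForm b * x)))
    {k : ℕ} {x : Forms C} (hx : x ∈ ⋀[C]^k (Kaehler C)) : p k x := by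
  induction hx using Submodule.pow_induction_on_left' with
  | algebraMap r => exact halg r
  | add x y i _ _ hx hy => exact hadd _ _ _ hx hy
  | mem_mul m hm i x hx ih =>
    obtain ⟨e, rfl⟩ := hm
    induction e using kaehler_induction with
    | h0 =>
      have := hmul i 0 0 x hx ih
      rw [map_zero, zero_mul] at this
      rwa [map_zero, zero_mul]
    | hadd u v hu hv => rw [map_add, add_mul]; exact hadd _ _ _ hu hv
    | hd a b =>
      rw [map_smul, Algebra.smul_def, mul_assoc]
      exact hmul i a b x hx ih

theorem dForm_mem (b : C) : dForm b ∈ ⋀[C]^1 (Kaehler C) := by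
  simp [dForm]

theorem mul_mem_forms {k l m : ℕ} (h : k + l = m) {x y : Forms C} (hx : x ∈ ⋀[C]^k (Kaehler C))
    (hy : y ∈ ⋀[C]^l (Kaehler C)) : x * y ∈ ⋀[C]^m (Kaehler C) := by
  subst h
  exact SetLike.mul_mem_graded (A := fun i : ℕ => ⋀[C]^i (Kaehler C)) hx hy

theorem signInv_eq {k : ℕ} {x : Forms C} (hx : x ∈ ⋀[C]^k (Kaehler C)) :
    signInv x = (-1 : ℤ) ^ k • x := by
  refine forms_degree_induction (p := fun k x => signInv x = (-1 : ℤ) ^ k • x) ?_ ?_ ?_ hx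
  · intro a; simp
  · intro k x y hx hy; rw [map_add, hx, hy, smul_add]
  · intro k a b x _ hx
    rw [map_mul, map_mul, hx, signInv_dForm, AlgHom.commutes, pow_succ, neg_mul,
      mul_smul_comm, mul_neg, mul_smul_comm, mul_neg_one, neg_smul]

theorem extDeriv_mem {k : ℕ} {x : Forms C} (hx : x ∈ ⋀[C]^k (Kaehler C)) :
    extDeriv C x ∈ ⋀[C]^(k + 1) (Kaehler C) := by
  refine forms_degree_induction
    (p := fun k x => extDeriv C x ∈ ⋀[C]^(k + 1) (Kaehler C)) ?_ ?_ ?_ hx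
  · intro a; rw [extDeriv_algebraMap]; exact dForm_mem a
  · intro k x y hx hy; rw [map_add]; exact add_mem hx hy
  · intro k a b x hx ih
    rw [extDeriv_mul, extDeriv_mul, extDeriv_algebraMap, extDeriv_dForm, zero_mul, zero_add,
      AlgHom.commutes, signInv_dForm, ← Algebra.smul_def]
    refine add_mem (mul_mem_forms (add_comm 1 (k + 1)) (dForm_mem a)
      (mul_mem_forms (add_comm 1 k) (dForm_mem b) hx)) (Submodule.smul_mem _ _ ?_)
    exact mul_mem_forms (add_comm 1 (k + 1)) (neg_mem (dForm_mem b)) ih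

theorem forms_mul_comm {k l : ℕ} {x y : Forms C} (hx : x ∈ ⋀[C]^k (Kaehler C))
    (hy : y ∈ ⋀[C]^l (Kaehler C)) : y * x = (-1 : ℤ) ^ (k * l) • (x * y) := by
  refine forms_degree_induction
    (p := fun l y => y * x = (-1 : ℤ) ^ (k * l) • (x * y)) ?_ ?_ ?_ hy
  · intro a; rw [Algebra.commutes]; simp
  · intro k y z hy hz; rw [add_mul, hy, hz, mul_add, smul_add]
  · intro l a b y hy ih
    have h1 : dForm b * (x * y) = (-1 : ℤ) ^ k • (x * (dForm b * y)) := by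
      rw [← mul_assoc, dForm_mul, signInv_eq hx, smul_mul_assoc, smul_mul_assoc, mul_assoc]
    rw [mul_assoc, mul_assoc, ih, mul_smul_comm, h1, ← Algebra.smul_def, ← Algebra.smul_def,
      mul_smul_comm, smul_smul, ← pow_add, ← mul_add_one, smul_comm]

end CInftyRing

namespace CInftyRing

variable {C D : Type u} [CInftyRing C] [CInftyRing D]

/-- The exterior algebra of `Ω¹_D` as an algebra over `C`, along a morphism `C → D`. -/
abbrev formsAlgebra (φ : Hom C D) : Algebra C (Forms D) :=
  ((algebraMap D (Forms D)).comp φ.toRingHom).toAlgebra'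
    (fun a x => Algebra.commutes (φ.toFun a) x)

/-- The ring homomorphism of exterior algebras induced by a morphism of `C^∞`-rings, given by
`a ↦ φ a` and `d b ↦ d (φ b)`. -/
def formsMap (φ : Hom C D) : Forms C →+* Forms D :=
  letI := formsAlgebra φ
  have hX : IsDerivation (C := C) (N := Forms D) (fun b => dForm (φ.toFun b)) := by
    intro n f a
    change dForm (φ.toFun (op f a)) = _
    rw [φ.map_op, dForm, kaehlerD_isDerivation n f, map_sum]
    refine Finset.sum_congr rfl fun i _ => ?_
    rw [map_smul, Algebra.smul_def, Algebra.smul_def, ← φ.map_op]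
    rfl
  have hmem : ∀ x : Kaehler C, ∃ y : Kaehler D, kaehlerLift _ hX x = ExteriorAlgebra.ι D y := by
    intro x
    induction x using kaehler_induction with
    | h0 => exact ⟨0, by rw [map_zero, map_zero]⟩
    | hadd x y hx hy =>
      obtain ⟨x', hx⟩ := hx
      obtain ⟨y', hy⟩ := hy
      exact ⟨x' + y', by rw [map_add, map_add, hx, hy]⟩
    | hd a b =>
      refine ⟨φ.toFun a • kaehlerD (φ.toFun b), ?_⟩
      rw [map_smul, map_smul, kaehlerLift_d, Algebra.smul_def, Algebra.smul_def]
      rfl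
  (ExteriorAlgebra.lift C ⟨kaehlerLift _ hX, fun x => by
    obtain ⟨y, hy⟩ := hmem x
    rw [hy, ExteriorAlgebra.ι_sq_zero]⟩ : Forms C →ₐ[C] Forms D).toRingHom

theorem formsMap_algebraMap (φ : Hom C D) (a : C) :
    formsMap φ (algebraMap C (Forms C) a) = algebraMap D (Forms D) (φ.toFun a) := by
  let _ := formsAlgebra φ
  exact AlgHom.commutes (R := C) (B := Forms D) _ a

theorem formsMap_dForm (φ : Hom C D) (b : C) : formsMap φ (dForm b) = dForm (φ.toFun b) := by
  let _ := formsAlgebra φ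
  refine (ExteriorAlgebra.lift_ι_apply (R := C) (A := Forms D) _ _ (kaehlerD b)).trans ?_
  exact kaehlerLift_d (C := C) (N := Forms D) _ _ b

theorem formsMap_signInv (φ : Hom C D) (x : Forms C) :
    formsMap φ (signInv x) = signInv (formsMap φ x) := by
  induction x using forms_induction with
  | halg a => rw [AlgHom.commutes, formsMap_algebraMap, AlgHom.commutes]
  | hd b => rw [signInv_dForm, map_neg, formsMap_dForm, signInv_dForm]
  | hmul x y hx hy => simp only [map_mul, hx, hy]
  | hadd x y hx hy => simp only [map_add, hx, hy]

theorem formsMap_extDeriv (φ : Hom C D) (x : Forms C) :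
    formsMap φ (extDeriv C x) = extDeriv D (formsMap φ x) := by
  induction x using forms_induction with
  | halg a => rw [extDeriv_algebraMap, formsMap_dForm, formsMap_algebraMap, extDeriv_algebraMap]
  | hd b => rw [extDeriv_dForm, map_zero, formsMap_dForm, extDeriv_dForm]
  | hmul x y hx hy =>
    rw [extDeriv_mul, map_add, map_mul, map_mul, map_mul, extDeriv_mul, hx, hy, formsMap_signInv]
  | hadd x y hx hy => simp only [map_add, hx, hy]

theorem formsMap_mem (φ : Hom C D) {k : ℕ} {x : Forms C} (hx : x ∈ ⋀[C]^k (Kaehler C)) :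
    formsMap φ x ∈ ⋀[D]^k (Kaehler D) := by
  refine forms_degree_induction
    (p := fun k x => formsMap φ x ∈ ⋀[D]^k (Kaehler D)) ?_ ?_ ?_ hx
  · intro a
    rw [formsMap_algebraMap]
    rw [Algebra.algebraMap_eq_smul_one]
    exact Submodule.smul_mem _ _ (SetLike.one_mem_graded (fun i : ℕ => ⋀[D]^i (Kaehler D)))
  · intro k x y hx hy; rw [map_add]; exact add_mem hx hy
  · intro k a b x _ ih
    rw [map_mul, map_mul, formsMap_algebraMap, formsMap_dForm, ← Algebra.smul_def]
    exact Submodule.smul_mem _ _ (mul_mem_forms (add_comm 1 k) (dForm_mem _) ih)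

end CInftyRing

/-! ### The categories of `C^∞`-rings and of commutative differential graded algebras -/

/-- The type of objects of the category of `C^∞`-rings. -/
structure CInftyRingCat : Type (u + 1) where
  carrier : Type u
  [str : CInftyRing carrier]

attribute [instance] CInftyRingCat.str

instance : CoeSort CInftyRingCat.{u} (Type u) := ⟨CInftyRingCat.carrier⟩

instance : Category CInftyRingCat.{u} where
  Hom C D := CInftyRing.Hom C D
  id C := ⟨fun c => c, fun _ _ => rfl⟩
  comp φ ψ := ⟨fun c => ψ.toFun (φ.toFun c), fun f c => by rw [φ.map_op, ψ.map_op]⟩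

/-- The underlying set of a `C^∞`-ring. -/
def CInftyRingCat.forgetToType : CInftyRingCat.{u} ⥤ Type u where
  obj C := C
  map φ := ↾φ.toFun

/-- A commutative differential graded algebra over a `C^∞`-ring, concentrated in non-negative
degrees. The product of elements of degrees `k` and `l` is allowed to land in any degree `m` with
a proof that `k + l = m`. -/
structure CDGA (C : Type u) [CInftyRing C] where
  obj : ℕ → Type u
  [addCommGroup : ∀ k, AddCommGroup (obj k)]
  [module : ∀ k, Module C (obj k)]
  wedge : ∀ {k l m : ℕ}, k + l = m → (obj k →ₗ[C] obj l →ₗ[C] obj m)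
  wedge_assoc : ∀ {k l m kl lm n : ℕ} (h₁ : k + l = kl) (h₂ : l + m = lm) (h₃ : kl + m = n)
    (h₄ : k + lm = n) (x : obj k) (y : obj l) (z : obj m),
    wedge h₃ (wedge h₁ x y) z = wedge h₄ x (wedge h₂ y z)
  wedge_comm : ∀ {k l m : ℕ} (h : k + l = m) (h' : l + k = m) (x : obj k) (y : obj l),
    wedge h' y x = (-1 : ℤ) ^ (k * l) • wedge h x y
  d : ∀ k : ℕ, obj k →+ obj (k + 1)
  d_const_smul : ∀ {k : ℕ} (r : ℝ) (x : obj k),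
    d k (CInftyRing.const C r • x) = CInftyRing.const C r • d k x
  d_wedge : ∀ {k l m : ℕ} (h : k + l = m) (h₁ : (k + 1) + l = m + 1) (h₂ : k + (l + 1) = m + 1)
    (x : obj k) (y : obj l),
    d m (wedge h x y) = wedge h₁ (d k x) y + (-1 : ℤ) ^ k • wedge h₂ x (d l y)
  d_d : ∀ {k : ℕ} (x : obj k), d (k + 1) (d k x) = 0

attribute [instance] CDGA.addCommGroup CDGA.module

/-- An object of the category of commutative differential graded algebras: a `C^∞`-ring together
with a commutative differential graded algebra over it. -/
structure CDGACat : Type (u + 1) where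
  ring : CInftyRingCat.{u}
  cdga : CDGA.{u} ring

/-- A morphism of commutative differential graded algebras: a morphism of `C^∞`-rings together
with additive maps in each degree, linear over it, which preserve products and commute with
the differentials. -/
@[ext]
structure CDGACat.Hom (P Q : CDGACat.{u}) where
  ringHom : P.ring ⟶ Q.ring
  map : ∀ k : ℕ, P.cdga.obj k →+ Q.cdga.obj k
  map_smul : ∀ {k : ℕ} (c : P.ring) (x : P.cdga.obj k),
    map k (c • x) = (ringHom.toFun c : Q.ring) • map k x
  map_wedge : ∀ {k l m : ℕ} (h : k + l = m) (x : P.cdga.obj k) (y : P.cdga.obj l),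
    map m (P.cdga.wedge h x y) = Q.cdga.wedge h (map k x) (map l y)
  map_d : ∀ {k : ℕ} (x : P.cdga.obj k), map (k + 1) (P.cdga.d k x) = Q.cdga.d k (map k x)

namespace CDGACat

instance : Category CDGACat.{u} where
  Hom P Q := CDGACat.Hom P Q
  id P :=
    { ringHom := 𝟙 P.ring
      map := fun _ => AddMonoidHom.id _
      map_smul := fun _ _ => rfl
      map_wedge := fun _ _ _ => rfl
      map_d := fun _ => rfl }
  comp F G :=
    { ringHom := F.ringHom ≫ G.ringHom
      map := fun k => (G.map k).comp (F.map k)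
      map_smul := fun c x => by
        simp only [AddMonoidHom.comp_apply, F.map_smul, G.map_smul]
        rfl
      map_wedge := fun h x y => by simp only [AddMonoidHom.comp_apply, F.map_wedge, G.map_wedge]
      map_d := fun x => by simp only [AddMonoidHom.comp_apply, F.map_d, G.map_d] }

/-- The underlying `C^∞`-ring. -/
def toRing : CDGACat.{u} ⥤ CInftyRingCat.{u} where
  obj P := P.ring
  map F := F.ringHom

/-- The set of elements of degree `k`. -/
def degree (k : ℕ) : CDGACat.{u} ⥤ Type u where
  obj P := P.cdga.obj k
  map F := ↾fun x => F.map k x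

end CDGACat

namespace CInftyRing

/-- The `C^∞`-algebraic de Rham complex `(Λ^• Ω¹_C, ∧, d)` of a `C^∞`-ring. -/
def deRham (C : Type u) [CInftyRing C] : CDGA.{u} C where
  obj k := ⋀[C]^k (Kaehler C)
  wedge h := LinearMap.mk₂ C (fun x y => ⟨x.1 * y.1, mul_mem_forms h x.2 y.2⟩)
    (fun x x' y => Subtype.ext (add_mul _ _ _)) (fun c x y => Subtype.ext (smul_mul_assoc _ _ _))
    (fun x y y' => Subtype.ext (mul_add _ _ _)) (fun c x y => Subtype.ext (mul_smul_comm _ _ _))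
  wedge_assoc _ _ _ _ x y z := Subtype.ext (mul_assoc x.1 y.1 z.1)
  wedge_comm _ _ x y := Subtype.ext (forms_mul_comm x.2 y.2)
  d k :=
    { toFun := fun x => ⟨extDeriv C x.1, extDeriv_mem x.2⟩
      map_zero' := Subtype.ext (map_zero _)
      map_add' := fun x y => Subtype.ext (map_add _ _ _) }
  d_const_smul r x := Subtype.ext (extDeriv_const_smul r x.1)
  d_wedge h h₁ h₂ x y := Subtype.ext (by
    refine (extDeriv_mul x.1 y.1).trans ?_
    rw [signInv_eq x.2, smul_mul_assoc]
    rfl)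
  d_d x := Subtype.ext (extDeriv_extDeriv x.1)

theorem formsMap_ext {C : Type u} {R : Type u} [CInftyRing C] [Ring R] (F G : Forms C →+* R)
    (h₀ : ∀ a, F (algebraMap C (Forms C) a) = G (algebraMap C (Forms C) a))
    (h₁ : ∀ b, F (dForm b) = G (dForm b)) (x : Forms C) : F x = G x := by
  induction x using forms_induction with
  | halg a => exact h₀ a
  | hd b => exact h₁ b
  | hmul x y hx hy => simp only [map_mul, hx, hy]
  | hadd x y hx hy => simp only [map_add, hx, hy]

/-- The functor sending a `C^∞`-ring to its `C^∞`-algebraic de Rham complex. -/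
def deRhamFunctor : CInftyRingCat.{u} ⥤ CDGACat.{u} where
  obj C := ⟨C, deRham C⟩
  map {C D} φ :=
    { ringHom := φ
      map := fun k =>
        { toFun := fun x => ⟨formsMap φ x.1, formsMap_mem φ x.2⟩
          map_zero' := Subtype.ext (map_zero _)
          map_add' := fun x y => Subtype.ext (map_add _ _ _) }
      map_smul := fun c x => Subtype.ext (by
        change formsMap φ (c • x.1) = φ.toFun c • formsMap φ x.1
        rw [Algebra.smul_def, map_mul, formsMap_algebraMap, Algebra.smul_def])
      map_wedge := fun h x y => Subtype.ext (map_mul (formsMap φ) x.1 y.1)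
      map_d := fun x => Subtype.ext (formsMap_extDeriv φ x.1) }
  map_id C := by
    refine CDGACat.Hom.ext rfl (funext fun k => AddMonoidHom.ext fun x => ?_)
    refine Subtype.ext (formsMap_ext (formsMap (𝟙 C)) (RingHom.id _) ?_ ?_ x.1)
    · intro a; rw [formsMap_algebraMap]; rfl
    · intro a; rw [formsMap_dForm]; rfl
  map_comp {C D E} φ ψ := by
    refine CDGACat.Hom.ext rfl (funext fun k => AddMonoidHom.ext fun x => ?_)
    refine Subtype.ext (formsMap_ext (formsMap (φ ≫ ψ)) ((formsMap ψ).comp (formsMap φ)) ?_ ?_ x.1)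
    · intro a
      rw [RingHom.comp_apply, formsMap_algebraMap, formsMap_algebraMap, formsMap_algebraMap]
      rfl
    · intro a
      rw [RingHom.comp_apply, formsMap_dForm, formsMap_dForm, formsMap_dForm]
      rfl

end CInftyRing

/-! ### Sheafification of presheaves of commutative differential graded algebras -/

/-- A natural unary operation between presheaves of sets. -/
structure NatOp₁ {X : TopCat.{u}} (F G : X.Presheaf (Type u)) where
  app : ∀ U : (Opens X)ᵒᵖ, F.obj U → G.obj U
  naturality : ∀ {U V : (Opens X)ᵒᵖ} (i : U ⟶ V) (a : F.obj U),
    G.map i (app U a) = app V (F.map i a)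

/-- A natural binary operation between presheaves of sets. -/
structure NatOp₂ {X : TopCat.{u}} (F G H : X.Presheaf (Type u)) where
  app : ∀ U : (Opens X)ᵒᵖ, F.obj U → G.obj U → H.obj U
  naturality : ∀ {U V : (Opens X)ᵒᵖ} (i : U ⟶ V) (a : F.obj U) (b : G.obj U),
    H.map i (app U a b) = app V (F.map i a) (G.map i b)

section SheafifyOps

variable {X : TopCat.{u}} {F G H : X.Presheaf (Type u)}

theorem exists_common_germ {x : X} {U : Opens X} (hx : x ∈ U) (a : F.stalk x) (b : G.stalk x)
    (c : H.stalk x) : ∃ (W : Opens X) (_ : W ⟶ U) (hW : x ∈ W) (a' : F.obj (op W))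
      (b' : G.obj (op W)) (c' : H.obj (op W)), F.germ W x hW a' = a ∧ G.germ W x hW b' = b ∧
        H.germ W x hW c' = c := by
  obtain ⟨V₁, h₁, a', rfl⟩ := F.exists_germ_eq a
  obtain ⟨V₂, h₂, b', rfl⟩ := G.exists_germ_eq b
  obtain ⟨V₃, h₃, c', rfl⟩ := H.exists_germ_eq c
  refine ⟨U ⊓ (V₁ ⊓ (V₂ ⊓ V₃)), homOfLE inf_le_left, ⟨hx, h₁, h₂, h₃⟩,
    F.map (homOfLE (inf_le_right.trans inf_le_left)).op a',
    G.map (homOfLE (inf_le_right.trans (inf_le_right.trans inf_le_left))).op b',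
    H.map (homOfLE (inf_le_right.trans (inf_le_right.trans inf_le_right))).op c', ?_, ?_, ?_⟩
  · exact F.germ_res_apply _ _ _ _
  · exact G.germ_res_apply _ _ _ _
  · exact H.germ_res_apply _ _ _ _

/-- The operation on stalks induced by a natural unary operation. -/
def NatOp₁.onStalk (m : NatOp₁ F G) {x : X} (a : F.stalk x) : G.stalk x :=
  G.germ (F.exists_germ_eq a).choose x (F.exists_germ_eq a).choose_spec.choose
    (m.app _ (F.exists_germ_eq a).choose_spec.choose_spec.choose)

theorem NatOp₁.onStalk_germ (m : NatOp₁ F G) {x : X} {U : Opens X} (hx : x ∈ U)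
    (a : F.obj (op U)) : m.onStalk (F.germ U x hx a) = G.germ U x hx (m.app _ a) := by
  have hV := (F.exists_germ_eq (F.germ U x hx a)).choose_spec.choose
  have e := (F.exists_germ_eq (F.germ U x hx a)).choose_spec.choose_spec.choose_spec
  obtain ⟨W, hW, i, j, h⟩ := F.germ_eq x _ hx _ _ e
  refine G.germ_ext W hW i j ?_
  rw [m.naturality, m.naturality]
  exact congrArg _ h

/-- The operation on stalks induced by a natural binary operation. -/
def NatOp₂.onStalk (m : NatOp₂ F G H) {x : X} (a : F.stalk x) (b : G.stalk x) : H.stalk x :=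
  let h := exists_common_germ (F := F) (G := G) (H := G) (U := ⊤) trivial a b b
  H.germ h.choose x h.choose_spec.choose_spec.choose
    (m.app _ h.choose_spec.choose_spec.choose_spec.choose
      h.choose_spec.choose_spec.choose_spec.choose_spec.choose)

theorem NatOp₂.onStalk_germ (m : NatOp₂ F G H) {x : X} {U : Opens X} (hx : x ∈ U)
    (a : F.obj (op U)) (b : G.obj (op U)) :
    m.onStalk (F.germ U x hx a) (G.germ U x hx b) = H.germ U x hx (m.app _ a b) := by
  have h := exists_common_germ (F := F) (G := G) (H := G) (U := ⊤) trivial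
    (F.germ U x hx a) (G.germ U x hx b) (G.germ U x hx b)
  have e := h.choose_spec.choose_spec.choose_spec.choose_spec.choose_spec.choose_spec
  obtain ⟨W₁, hW₁, i₁, j₁, e₁⟩ := F.germ_eq x _ hx _ _ e.1
  obtain ⟨W₂, hW₂, i₂, j₂, e₂⟩ := G.germ_eq x _ hx _ _ e.2.1
  refine H.germ_ext (W₁ ⊓ W₂) ⟨hW₁, hW₂⟩ (homOfLE inf_le_left ≫ i₁) (homOfLE inf_le_left ≫ j₁) ?_
  rw [m.naturality, m.naturality]
  have e₁' := congrArg (F.map (homOfLE (inf_le_left : W₁ ⊓ W₂ ≤ W₁)).op) e₁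
  have e₂' := congrArg (G.map (homOfLE (inf_le_right : W₁ ⊓ W₂ ≤ W₂)).op) e₂
  rw [← ConcreteCategory.comp_apply, ← ConcreteCategory.comp_apply, ← F.map_comp,
    ← F.map_comp] at e₁'
  rw [← ConcreteCategory.comp_apply, ← ConcreteCategory.comp_apply, ← G.map_comp,
    ← G.map_comp] at e₂'
  exact congr (congrArg (m.app _) e₁') e₂'

/-- The operation on sections of sheafifications induced by a natural unary operation. -/
def NatOp₁.onSheafify (m : NatOp₁ F G) {U : (Opens X)ᵒᵖ} (s : F.sheafify.1.obj U) :
    G.sheafify.1.obj U :=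
  ⟨fun x => m.onStalk (s.1 x), fun x => by
    obtain ⟨V, hV, i, g, hg⟩ := s.2 x
    refine ⟨V, hV, i, m.app _ g, fun y => ?_⟩
    exact (congrArg m.onStalk (hg y)).trans (m.onStalk_germ y.2 g)⟩

/-- The operation on sections of sheafifications induced by a natural binary operation. -/
def NatOp₂.onSheafify (m : NatOp₂ F G H) {U : (Opens X)ᵒᵖ} (s : F.sheafify.1.obj U)
    (t : G.sheafify.1.obj U) : H.sheafify.1.obj U :=
  ⟨fun x => m.onStalk (s.1 x) (t.1 x), fun x => by
    obtain ⟨V₁, hV₁, i₁, g₁, hg₁⟩ := s.2 x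
    obtain ⟨V₂, hV₂, i₂, g₂, hg₂⟩ := t.2 x
    refine ⟨V₁ ⊓ V₂, ⟨hV₁, hV₂⟩, homOfLE inf_le_left ≫ i₁,
      m.app _ (F.map (homOfLE (inf_le_left : V₁ ⊓ V₂ ≤ V₁)).op g₁)
        (G.map (homOfLE (inf_le_right : V₁ ⊓ V₂ ≤ V₂)).op g₂), fun y => ?_⟩
    have h₁ := hg₁ ⟨y.1, y.2.1⟩
    have h₂ := hg₂ ⟨y.1, y.2.2⟩
    rw [← m.onStalk_germ y.2, F.germ_res_apply, G.germ_res_apply]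
    exact congr (congrArg m.onStalk h₁) h₂⟩

theorem germ_eq_germ_res {U W : Opens X} (i : W ⟶ U) {x : X} (hU : x ∈ U) (hW : x ∈ W)
    (a : F.obj (op U)) : F.germ U x hU a = F.germ W x hW (F.map i.op a) :=
  (F.germ_res_apply i x hW a).symm

end SheafifyOps

namespace CDGACat

variable {X : TopCat.{u}} (P : X.Presheaf CDGACat.{u})

/-- The presheaf of sets underlying the presheaf of rings. -/
abbrev ringPsh : X.Presheaf (Type u) := P ⋙ toRing ⋙ CInftyRingCat.forgetToType

/-- The presheaf of sets of elements of degree `k`. -/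
abbrev degPsh (k : ℕ) : X.Presheaf (Type u) := P ⋙ degree k

/-- Addition in degree `k`. -/
def addOp (k : ℕ) : NatOp₂ (degPsh P k) (degPsh P k) (degPsh P k) where
  app U := fun (a b : (P.obj U).cdga.obj k) => a + b
  naturality i a b := ((P.map i).map k).map_add' a b

/-- Negation in degree `k`. -/
def negOp (k : ℕ) : NatOp₁ (degPsh P k) (degPsh P k) where
  app U := fun (a : (P.obj U).cdga.obj k) => -a
  naturality {U _} i (a : (P.obj U).cdga.obj k) := map_neg ((P.map i).map k) a

/-- Scalar multiplication in degree `k`. -/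
def smulOp (k : ℕ) : NatOp₂ (ringPsh P) (degPsh P k) (degPsh P k) where
  app U := fun (c : (P.obj U).ring) (a : (P.obj U).cdga.obj k) => c • a
  naturality i c a := (P.map i).map_smul c a

/-- The wedge product of elements of degrees `k` and `l`. -/
def wedgeOp {k l m : ℕ} (h : k + l = m) : NatOp₂ (degPsh P k) (degPsh P l) (degPsh P m) where
  app U := fun (a : (P.obj U).cdga.obj k) (b : (P.obj U).cdga.obj l) => (P.obj U).cdga.wedge h a b
  naturality i a b := (P.map i).map_wedge h a b

/-- The differential in degree `k`. -/
def dOp (k : ℕ) : NatOp₁ (degPsh P k) (degPsh P (k + 1)) where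
  app U := fun (a : (P.obj U).cdga.obj k) => (P.obj U).cdga.d k a
  naturality i a := (P.map i).map_d a

/-- The sections over `U` of the sheafification of the presheaf of elements of degree `k`. -/
def ShSec (k : ℕ) (U : (Opens X)ᵒᵖ) : Type u := (degPsh P k).sheafify.1.obj U

variable {P} {k : ℕ} {U : (Opens X)ᵒᵖ}

/-- The value of a section of the sheafification in the stalk at a point. -/
def ShSec.val (s : ShSec P k U) (x : U.unop) : (degPsh P k).stalk x.1 := Subtype.val s x

theorem ShSec.ext {s t : ShSec P k U} (h : ∀ x, s.val x = t.val x) : s = t :=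
  Subtype.ext (funext h)

/-- The germ of an element of degree `k`. -/
def dgerm {W : Opens X} {x : X} (hx : x ∈ W) (a : (P.obj (op W)).cdga.obj k) :
    (degPsh P k).stalk x := (degPsh P k).germ W x hx a

/-- The germ of an element of the ring. -/
def rgerm {W : Opens X} {x : X} (hx : x ∈ W) (a : (P.obj (op W)).ring) :
    (ringPsh P).stalk x := (ringPsh P).germ W x hx a

theorem exists_dgerm {k l m : ℕ} {x : X} {V : Opens X} (hx : x ∈ V) (a : (degPsh P k).stalk x)
    (b : (degPsh P l).stalk x) (c : (degPsh P m).stalk x) :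
    ∃ (W : Opens X) (_ : W ⟶ V) (hW : x ∈ W) (a' : (P.obj (op W)).cdga.obj k)
      (b' : (P.obj (op W)).cdga.obj l) (c' : (P.obj (op W)).cdga.obj m),
      a = dgerm hW a' ∧ b = dgerm hW b' ∧ c = dgerm hW c' := by
  obtain ⟨W, i, hW, a', b', c', ha, hb, hc⟩ := exists_common_germ hx a b c
  exact ⟨W, i, hW, a', b', c', ha.symm, hb.symm, hc.symm⟩

theorem dgerm_res {V W : Opens X} (i : W ⟶ V) {x : X} (hV : x ∈ V) (hW : x ∈ W)
    (a : (P.obj (op V)).cdga.obj k) : dgerm hV a = dgerm hW ((P.map i.op).map k a) :=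
  germ_eq_germ_res (F := degPsh P k) i hV hW a

theorem rgerm_res {V W : Opens X} (i : W ⟶ V) {x : X} (hV : x ∈ V) (hW : x ∈ W)
    (a : (P.obj (op V)).ring) : rgerm hV a = rgerm hW ((P.map i.op).ringHom.toRingHom a) :=
  germ_eq_germ_res (F := ringPsh P) i hV hW a

section Germs

variable {W : Opens X} {x : X} (hx : x ∈ W)

theorem add_germ (a b : (P.obj (op W)).cdga.obj k) :
    (addOp P k).onStalk (dgerm hx a) (dgerm hx b) = dgerm hx (a + b) :=
  (addOp P k).onStalk_germ hx a b

theorem neg_germ (a : (P.obj (op W)).cdga.obj k) :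
    (negOp P k).onStalk (dgerm hx a) = dgerm hx (-a) :=
  (negOp P k).onStalk_germ hx a

theorem smul_germ (c : (P.obj (op W)).ring) (a : (P.obj (op W)).cdga.obj k) :
    (smulOp P k).onStalk (rgerm hx c) (dgerm hx a) = dgerm hx (c • a) :=
  (smulOp P k).onStalk_germ hx c a

theorem wedge_germ {k l m : ℕ} (h : k + l = m) (a : (P.obj (op W)).cdga.obj k)
    (b : (P.obj (op W)).cdga.obj l) :
    (wedgeOp P h).onStalk (dgerm hx a) (dgerm hx b)
      = dgerm hx ((P.obj (op W)).cdga.wedge h a b) :=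
  (wedgeOp P h).onStalk_germ hx a b

theorem d_germ (a : (P.obj (op W)).cdga.obj k) :
    (dOp P k).onStalk (dgerm hx a) = dgerm hx ((P.obj (op W)).cdga.d k a) :=
  (dOp P k).onStalk_germ hx a

end Germs

instance : Add (ShSec P k U) := ⟨fun s t => (addOp P k).onSheafify s t⟩
instance : Neg (ShSec P k U) := ⟨fun s => (negOp P k).onSheafify s⟩
instance : Zero (ShSec P k U) :=
  ⟨(degPsh P k).toSheafify.app U (0 : (P.obj U).cdga.obj k)⟩
instance : SMul (P.obj U).ring (ShSec P k U) :=
  ⟨fun c s => (smulOp P k).onSheafify ((ringPsh P).toSheafify.app U c) s⟩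

theorem add_val (s t : ShSec P k U) (x : U.unop) :
    (s + t).val x = (addOp P k).onStalk (s.val x) (t.val x) := rfl

theorem neg_val (s : ShSec P k U) (x : U.unop) :
    (-s).val x = (negOp P k).onStalk (s.val x) := rfl

theorem zero_val (x : U.unop) {W : Opens X} (i : W ⟶ U.unop) (hW : x.1 ∈ W) :
    (0 : ShSec P k U).val x = dgerm hW 0 := by
  change dgerm (P := P) (W := U.unop) x.2 (0 : (P.obj U).cdga.obj k) = _
  rw [dgerm_res i x.2 hW, map_zero]

theorem smul_val (c : (P.obj U).ring) (s : ShSec P k U) (x : U.unop) {W : Opens X}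
    (i : W ⟶ U.unop) (hW : x.1 ∈ W) :
    (c • s).val x = (smulOp P k).onStalk
      (rgerm hW ((P.map i.op).ringHom.toRingHom c)) (s.val x) := by
  rw [← rgerm_res i x.2 hW]
  rfl

instance : AddCommGroup (ShSec P k U) where
  add_assoc s t r := ShSec.ext fun x => by
    obtain ⟨W, i, hW, a, b, c, ha, hb, hc⟩ := exists_dgerm x.2 (s.val x) (t.val x) (r.val x)
    simp only [add_val, ha, hb, hc, add_germ, add_assoc]
  zero_add s := ShSec.ext fun x => by
    obtain ⟨W, i, hW, a, b, c, ha, hb, hc⟩ := exists_dgerm x.2 (s.val x) (s.val x) (s.val x)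
    rw [add_val, zero_val x i hW, ha, add_germ, zero_add]
  add_zero s := ShSec.ext fun x => by
    obtain ⟨W, i, hW, a, b, c, ha, hb, hc⟩ := exists_dgerm x.2 (s.val x) (s.val x) (s.val x)
    rw [add_val, zero_val x i hW, ha, add_germ, add_zero]
  nsmul := nsmulRec
  zsmul := zsmulRec
  neg_add_cancel s := ShSec.ext fun x => by
    obtain ⟨W, i, hW, a, b, c, ha, hb, hc⟩ := exists_dgerm x.2 (s.val x) (s.val x) (s.val x)
    rw [add_val, neg_val, zero_val x i hW, ha, neg_germ, add_germ, neg_add_cancel]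
  add_comm s t := ShSec.ext fun x => by
    obtain ⟨W, i, hW, a, b, c, ha, hb, hc⟩ := exists_dgerm x.2 (s.val x) (t.val x) (t.val x)
    rw [add_val, add_val, ha, hb, add_germ, add_germ, add_comm]

instance : Module (P.obj U).ring (ShSec P k U) where
  one_smul s := ShSec.ext fun x => by
    obtain ⟨W, i, hW, a, b, c, ha, hb, hc⟩ := exists_dgerm x.2 (s.val x) (s.val x) (s.val x)
    rw [smul_val _ _ x i hW, ha, smul_germ, map_one, one_smul]
  mul_smul r r' s := ShSec.ext fun x => by
    obtain ⟨W, i, hW, a, b, c, ha, hb, hc⟩ := exists_dgerm x.2 (s.val x) (s.val x) (s.val x)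
    rw [smul_val _ _ x i hW, smul_val _ _ x i hW, smul_val _ _ x i hW, ha, smul_germ, smul_germ,
      smul_germ, map_mul, mul_smul]
  smul_zero r := ShSec.ext fun x => by
    rw [smul_val _ _ x (𝟙 _) x.2, zero_val x (𝟙 _) x.2, smul_germ, smul_zero]
  smul_add r s t := ShSec.ext fun x => by
    obtain ⟨W, i, hW, a, b, c, ha, hb, hc⟩ := exists_dgerm x.2 (s.val x) (t.val x) (s.val x)
    rw [add_val, smul_val _ _ x i hW, smul_val _ _ x i hW, smul_val _ _ x i hW, add_val,
      ha, hb, smul_germ, smul_germ, add_germ, add_germ, smul_germ, smul_add]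
  add_smul r r' s := ShSec.ext fun x => by
    obtain ⟨W, i, hW, a, b, c, ha, hb, hc⟩ := exists_dgerm x.2 (s.val x) (s.val x) (s.val x)
    rw [add_val, smul_val _ _ x i hW, smul_val _ _ x i hW, smul_val _ _ x i hW, ha, smul_germ,
      smul_germ, smul_germ, add_germ, map_add, add_smul]
  zero_smul s := ShSec.ext fun x => by
    obtain ⟨W, i, hW, a, b, c, ha, hb, hc⟩ := exists_dgerm x.2 (s.val x) (s.val x) (s.val x)
    rw [smul_val _ _ x i hW, zero_val x i hW, ha, smul_germ, map_zero, zero_smul]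

theorem sign_val (n : ℕ) (s : ShSec P k U) (x : U.unop) {W : Opens X} (hW : x.1 ∈ W)
    (a : (P.obj (op W)).cdga.obj k) (ha : s.val x = dgerm hW a) :
    ((-1 : ℤ) ^ n • s).val x = dgerm hW ((-1 : ℤ) ^ n • a) := by
  rcases neg_one_pow_eq_or ℤ n with h | h
  · rw [h, one_smul, one_smul, ha]
  · rw [h, neg_smul, one_smul, neg_smul, one_smul, neg_val, ha, neg_germ]

/-- The wedge product of sections of the sheafifications, as a function. -/
def wedgeFun {k l m : ℕ} (h : k + l = m) (s : ShSec P k U) (t : ShSec P l U) : ShSec P m U :=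
  (wedgeOp P h).onSheafify s t

theorem wedgeFun_val {k l m : ℕ} (h : k + l = m) (s : ShSec P k U) (t : ShSec P l U)
    (x : U.unop) : (wedgeFun h s t).val x = (wedgeOp P h).onStalk (s.val x) (t.val x) := rfl

/-- The wedge product of sections of the sheafifications. -/
def shWedge {k l m : ℕ} (h : k + l = m) :
    ShSec P k U →ₗ[(P.obj U).ring] ShSec P l U →ₗ[(P.obj U).ring] ShSec P m U :=
  LinearMap.mk₂ _ (wedgeFun h)
    (fun s s' t => ShSec.ext fun x => by
      obtain ⟨W, i, hW, a, b, c, ha, hb, hc⟩ := exists_dgerm x.2 (s.val x) (s'.val x) (t.val x)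
      change (wedgeOp P h).onStalk ((addOp P k).onStalk (s.val x) (s'.val x)) (t.val x)
        = (addOp P m).onStalk ((wedgeOp P h).onStalk (s.val x) (t.val x))
          ((wedgeOp P h).onStalk (s'.val x) (t.val x))
      simp only [ha, hb, hc, add_germ, wedge_germ, map_add, LinearMap.add_apply])
    (fun r s t => ShSec.ext fun x => by
      obtain ⟨W, i, hW, a, b, c, ha, hb, hc⟩ := exists_dgerm x.2 (s.val x) (t.val x) (t.val x)
      rw [wedgeFun_val, smul_val _ _ x i hW, smul_val _ _ x i hW, wedgeFun_val]
      simp only [ha, hb, smul_germ, wedge_germ, map_smul, LinearMap.smul_apply])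
    (fun s t t' => ShSec.ext fun x => by
      obtain ⟨W, i, hW, a, b, c, ha, hb, hc⟩ := exists_dgerm x.2 (s.val x) (t.val x) (t'.val x)
      change (wedgeOp P h).onStalk (s.val x) ((addOp P l).onStalk (t.val x) (t'.val x))
        = (addOp P m).onStalk ((wedgeOp P h).onStalk (s.val x) (t.val x))
          ((wedgeOp P h).onStalk (s.val x) (t'.val x))
      simp only [ha, hb, hc, add_germ, wedge_germ, map_add])
    (fun r s t => ShSec.ext fun x => by
      obtain ⟨W, i, hW, a, b, c, ha, hb, hc⟩ := exists_dgerm x.2 (s.val x) (t.val x) (t.val x)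
      rw [wedgeFun_val, smul_val _ _ x i hW, smul_val _ _ x i hW, wedgeFun_val]
      simp only [ha, hb, smul_germ, wedge_germ, map_smul])

theorem shWedge_val {k l m : ℕ} (h : k + l = m) (s : ShSec P k U) (t : ShSec P l U)
    (x : U.unop) : (shWedge h s t).val x = (wedgeOp P h).onStalk (s.val x) (t.val x) := rfl

/-- The differential of sections of the sheafifications. -/
def shD (k : ℕ) : ShSec P k U →+ ShSec P (k + 1) U where
  toFun s := (dOp P k).onSheafify s
  map_zero' := ShSec.ext fun x => by
    change (dOp P k).onStalk ((0 : ShSec P k U).val x) = _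
    rw [zero_val x (𝟙 _) x.2, zero_val x (𝟙 _) x.2, d_germ, map_zero]
  map_add' s t := ShSec.ext fun x => by
    obtain ⟨W, i, hW, a, b, c, ha, hb, hc⟩ := exists_dgerm x.2 (s.val x) (t.val x) (t.val x)
    change (dOp P k).onStalk ((addOp P k).onStalk (s.val x) (t.val x))
      = (addOp P (k + 1)).onStalk ((dOp P k).onStalk (s.val x)) ((dOp P k).onStalk (t.val x))
    simp only [ha, hb, add_germ, d_germ, map_add]

theorem shD_val (s : ShSec P k U) (x : U.unop) :
    (shD k s).val x = (dOp P k).onStalk (s.val x) := rfl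

variable (P) in
/-- The commutative differential graded algebra of sections over `U` of the sheafification. -/
def shCDGA (U : (Opens X)ᵒᵖ) : CDGA.{u} (P.obj U).ring where
  obj k := ShSec P k U
  wedge h := shWedge h
  wedge_assoc h₁ h₂ h₃ h₄ s t r := ShSec.ext fun x => by
    obtain ⟨W, i, hW, a, b, c, ha, hb, hc⟩ := exists_dgerm x.2 (s.val x) (t.val x) (r.val x)
    simp only [shWedge_val, ha, hb, hc, wedge_germ]
    rw [(P.obj (op W)).cdga.wedge_assoc h₁ h₂ h₃ h₄]
  wedge_comm {k l m} h h' s t := ShSec.ext fun x => by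
    obtain ⟨W, i, hW, a, b, c, ha, hb, hc⟩ := exists_dgerm x.2 (s.val x) (t.val x) (t.val x)
    have hst : (shWedge h s t).val x = dgerm hW ((P.obj (op W)).cdga.wedge h a b) := by
      rw [shWedge_val, ha, hb, wedge_germ]
    rw [sign_val _ _ x hW _ hst, shWedge_val, ha, hb, wedge_germ,
      (P.obj (op W)).cdga.wedge_comm h h']
  d k := shD k
  d_const_smul {k} r s := ShSec.ext fun x => by
    obtain ⟨W, i, hW, a, b, c, ha, hb, hc⟩ := exists_dgerm x.2 (s.val x) (s.val x) (s.val x)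
    rw [shD_val, smul_val _ _ x i hW, smul_val _ _ x i hW, shD_val, ha,
      CInftyRing.Hom.toRingHom_apply, CInftyRing.Hom.map_const, smul_germ, d_germ, d_germ,
      smul_germ, (P.obj (op W)).cdga.d_const_smul]
  d_wedge {k l m} h h₁ h₂ s t := ShSec.ext fun x => by
    obtain ⟨W, i, hW, a, b, c, ha, hb, hc⟩ := exists_dgerm x.2 (s.val x) (t.val x) (t.val x)
    have hst : (shWedge h₂ s (shD l t)).val x
        = dgerm hW ((P.obj (op W)).cdga.wedge h₂ a ((P.obj (op W)).cdga.d l b)) := by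
      rw [shWedge_val, shD_val, ha, hb, d_germ, wedge_germ]
    rw [add_val, sign_val _ _ x hW _ hst]
    simp only [shD_val, shWedge_val, ha, hb, wedge_germ, d_germ, add_germ]
    rw [(P.obj (op W)).cdga.d_wedge h h₁ h₂]
  d_d {k} s := ShSec.ext fun x => by
    obtain ⟨W, i, hW, a, b, c, ha, hb, hc⟩ := exists_dgerm x.2 (s.val x) (s.val x) (s.val x)
    rw [shD_val, shD_val, zero_val x i hW, ha, d_germ, d_germ, (P.obj (op W)).cdga.d_d]

variable (P) in
/-- The sheafification of a presheaf of commutative differential graded algebras over a sheaf of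
`C^∞`-rings: the rings are unchanged, the presheaf of elements of each degree is sheafified, and
products and differentials are computed on germs. -/
def sheafify : X.Presheaf CDGACat.{u} where
  obj U := ⟨(P.obj U).ring, shCDGA P U⟩
  map {U _} i :=
    { ringHom := (P.map i).ringHom
      map := fun k =>
        { toFun := fun s => (degPsh P k).sheafify.1.map i s
          map_zero' := ShSec.ext (P := P) (k := k) fun x =>
            zero_val (P := P) (U := U) (k := k) ⟨x.1, i.unop.le x.2⟩ i.unop x.2
          map_add' := fun _ _ => rfl }
      map_smul := fun {k} c s => ShSec.ext (P := P) (k := k) fun x =>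
        smul_val (P := P) (U := U) (k := k) c s ⟨x.1, i.unop.le x.2⟩ i.unop x.2
      map_wedge := fun _ _ _ => rfl
      map_d := fun _ => rfl }
  map_id U := CDGACat.Hom.ext (CDGACat.toRing.congr_map (P.map_id U)) rfl
  map_comp i j := CDGACat.Hom.ext (CDGACat.toRing.congr_map (P.map_comp i j)) rfl

variable (P) in
/-- The canonical morphism from a presheaf of commutative differential graded algebras to its
sheafification, sending an element to its germs. -/
def toSheafify : P ⟶ sheafify P where
  app U :=
    { ringHom := 𝟙 (P.obj U).ring
      map := fun k =>
        { toFun := fun a => (degPsh P k).toSheafify.app U a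
          map_zero' := rfl
          map_add' := fun a b => ShSec.ext (P := P) (k := k) fun x =>
            (add_germ (P := P) (W := U.unop) x.2 a b).symm }
      map_smul := fun {k} c a => ShSec.ext (P := P) (k := k) fun x =>
        (smul_germ (P := P) (W := U.unop) x.2 c a).symm
      map_wedge := fun {_ _ m} h a b => ShSec.ext (P := P) (k := m) fun x =>
        (wedge_germ (P := P) (W := U.unop) x.2 h a b).symm
      map_d := fun {k} a => ShSec.ext (P := P) (k := (k + 1)) fun x =>
        (d_germ (P := P) (W := U.unop) x.2 a).symm }
  naturality _ _ i := CDGACat.Hom.ext rfl (funext fun k => AddMonoidHom.ext fun a =>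
    congrArg (fun f => f a) ((degPsh P k).toSheafify.naturality i))

end CDGACat

/-! ### `C^∞`-ringed spaces and sheaves of differential forms -/

/-- A `C^∞`-ringed space: a topological space with a sheaf of `C^∞`-rings. -/
structure CInftyRingedSpace : Type (u + 1) where
  carrier : TopCat.{u}
  presheaf : carrier.Presheaf CInftyRingCat.{u}
  isSheaf : TopCat.Presheaf.IsSheaf (presheaf ⋙ CInftyRingCat.forgetToType)

/-- A map `(f, f_#)` of `C^∞`-ringed spaces. -/
structure CInftyRingedSpace.Hom (M N : CInftyRingedSpace.{u}) where
  base : M.carrier ⟶ N.carrier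
  sharp : N.presheaf ⟶ (Opens.map base).op ⋙ M.presheaf

/-- A sheaf of commutative differential graded algebras (over a sheaf of `C^∞`-rings) on a
topological space: a presheaf of such that is a sheaf in each degree. -/
structure SheafOfCDGA (X : TopCat.{u}) : Type (u + 1) where
  presheaf : X.Presheaf CDGACat.{u}
  isSheaf_ring : TopCat.Presheaf.IsSheaf (presheaf ⋙ CDGACat.toRing ⋙ CInftyRingCat.forgetToType)
  isSheaf : ∀ k : ℕ, TopCat.Presheaf.IsSheaf (presheaf ⋙ CDGACat.degree k)

/-- A morphism of sheaves of commutative differential graded algebras is a morphism of the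
underlying presheaves. -/
instance (X : TopCat.{u}) : Category (SheafOfCDGA X) where
  Hom F G := F.presheaf ⟶ G.presheaf
  id F := 𝟙 F.presheaf
  comp α β := α ≫ β

/-- The pushforward `f_* F`, with `(f_* F)(U) = F(f⁻¹ U)`. -/
def SheafOfCDGA.pushforward {X Y : TopCat.{u}} (f : X ⟶ Y) (F : SheafOfCDGA X) :
    SheafOfCDGA Y where
  presheaf := (Opens.map f).op ⋙ F.presheaf
  isSheaf_ring := TopCat.Sheaf.pushforward_sheaf_of_sheaf f F.isSheaf_ring
  isSheaf k := TopCat.Sheaf.pushforward_sheaf_of_sheaf f (F.isSheaf k)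

namespace CInftyRingedSpace

/-- The presheaf `U ↦ (Λ^• Ω¹_{A(U)}, ∧, d)` of a `C^∞`-ringed space `(M, A)`. -/
def formsPresheaf (M : CInftyRingedSpace.{u}) : M.carrier.Presheaf CDGACat.{u} :=
  M.presheaf ⋙ CInftyRing.deRhamFunctor

/-- The sheaf of differential forms of a `C^∞`-ringed space: the sheafification of
`formsPresheaf`. -/
def formsSheaf (M : CInftyRingedSpace.{u}) : SheafOfCDGA M.carrier where
  presheaf := CDGACat.sheafify M.formsPresheaf
  isSheaf_ring := M.isSheaf
  isSheaf k := (CDGACat.degPsh M.formsPresheaf k).sheafify.2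

/-- The canonical map from the presheaf of forms to its sheafification. -/
def toFormsSheaf (M : CInftyRingedSpace.{u}) : M.formsPresheaf ⟶ M.formsSheaf.presheaf :=
  CDGACat.toSheafify M.formsPresheaf

/-- The map `Λ^• Ω¹_B → f_* Λ^• Ω¹_A` of presheaves induced by functoriality of `Λ^• Ω¹` from
`f_# : B(U) → A(f⁻¹ U)`. -/
def Hom.presheafPullback {M N : CInftyRingedSpace.{u}} (f : M.Hom N) :
    N.formsPresheaf ⟶ (Opens.map f.base).op ⋙ M.formsPresheaf :=
  Functor.whiskerRight f.sharp CInftyRing.deRhamFunctor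

end CInftyRingedSpace

end

/-! The argument is formal and uses nothing about Kähler differentials beyond functoriality. It
works for any morphism `φ : P ⟶ f_* Q` of presheaves of CDGAs along a continuous map `f : X ⟶ Y`,
and the theorem is the case of de Rham presheaves with `φ` induced by `f_#`.

A section of the sheafification over `U` is a family of germs, one in each stalk over `U`, that is
locally the family of germs of one section of the presheaf. All operations on such families are
pointwise on stalks.

Existence: `φ` induces on stalks the maps `P_{f x} → (f_* Q)_{f x} → Q_x`, which send the germ of `a
∈ P(W)` at `f x` to the germ of `φ_W(a) ∈ Q(f⁻¹ W)` at `x` (`stalkMap_dgerm`). Applying these maps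
pointwise sends a family `s` over `U` to the family `x ↦ stalkMap (s (f x))` over `f⁻¹ U`. If `s` is
given by `g` on `V`, the image is given by `φ_V(g)` on `f⁻¹ V`, so it is again a section. To see
that an algebraic operation is preserved, represent the germs involved at `f x` by elements over one
common neighbourhood `W`; the claim then becomes the corresponding property of `φ_W`, read through
`stalkMap_dgerm`. The same formula for germs gives compatibility with the canonical maps
(`toSheafify_sheafifyMap`).

Uniqueness (`sheafify_hom_ext`): every section of the sheafification of `P` lies locally in the
image of `toSheafify P`, and a section of the sheafification of `Q` is determined by its values in
the stalks. A morphism that commutes with restrictions is therefore determined by its composition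
with `toSheafify P`. The rings are left alone by this sheafification, so their part is determined as
well. -/

namespace CDGACat

/-! ### Maps on stalks along a continuous map. -/

section Pushforward

variable {X Y : TopCat.{u}} {f : X ⟶ Y} {P : Y.Presheaf CDGACat.{u}} {Q : X.Presheaf CDGACat.{u}}

/-- The map from the stalk at `f x` to the stalk at `x`, in degree `k`, induced by a morphism
`P ⟶ f_* Q`. -/
noncomputable def stalkMap (φ : P ⟶ (Opens.map f).op ⋙ Q) (k : ℕ) (x : X) :
    (degPsh P k).stalk (f x) ⟶ (degPsh Q k).stalk x :=
  (TopCat.Presheaf.stalkFunctor (Type u) (f x)).map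
      -- Taking elements of degree `k` commutes with pushforward by definition; stating the target
      -- as a pushforward makes its stalk the source of `stalkPushforward`.
      (show degPsh P k ⟶ (TopCat.Presheaf.pushforward (Type u) f).obj (degPsh Q k) from
        Functor.whiskerRight φ (degree k)) ≫
    (degPsh Q k).stalkPushforward (Type u) f x

/-- Both factors of `stalkMap` are characterised by their effect on germs: the first applies `φ_W`,
the second regards a germ of `f_* Q` over `W` as a germ of `Q` over `f⁻¹ W`. All later computations
with `stalkMap` go through this formula. -/
theorem stalkMap_dgerm (φ : P ⟶ (Opens.map f).op ⋙ Q) {k : ℕ} {x : X} {W : Opens Y}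
    (hx : f x ∈ W) (a : (P.obj (op W)).cdga.obj k) :
    stalkMap φ k x (dgerm hx a)
      = dgerm (W := (Opens.map f).obj W) hx ((φ.app (op W)).map k a) := by
  let ψ : degPsh P k ⟶ (TopCat.Presheaf.pushforward (Type u) f).obj (degPsh Q k) :=
    Functor.whiskerRight φ (degree k)
  have h₁ := TopCat.Presheaf.stalkFunctor_map_germ_apply W (f x) hx ψ a
  have h₂ := TopCat.Presheaf.stalkPushforward_germ (Type u) f (degPsh Q k) W x hx
  exact (congrArg ((degPsh Q k).stalkPushforward (Type u) f x) h₁).trans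
    (ConcreteCategory.congr_hom h₂ (ψ.app (op W) a))

/-! ### The induced map on sections and its algebraic properties. -/

/-- The map on sections of sheafifications induced by a morphism `P ⟶ f_* Q`. -/
noncomputable def sectionMap (φ : P ⟶ (Opens.map f).op ⋙ Q) (k : ℕ) (U : (Opens Y)ᵒᵖ)
    (s : ShSec P k U) :
    ShSec Q k ((Opens.map f).op.obj U) :=
  ⟨fun x => stalkMap φ k x.1 (s.val ⟨f x.1, x.2⟩), fun x => by
    obtain ⟨V, hV, i, g, hg⟩ := s.2 ⟨f x.1, x.2⟩
    -- If `s` is the family of germs of `g` on `V`, the new family consists of the germs of `φ_V(g)`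
    -- on the open neighbourhood `f⁻¹ V` of `x`.
    refine ⟨(Opens.map f).obj V, hV, (Opens.map f).map i, (φ.app (op V)).map k g, fun y => ?_⟩
    exact (congrArg (stalkMap φ k y.1) (hg ⟨f y.1, y.2⟩)).trans (stalkMap_dgerm φ y.2 g)⟩

theorem sectionMap_val (φ : P ⟶ (Opens.map f).op ⋙ Q) {k : ℕ} {U : (Opens Y)ᵒᵖ}
    (s : ShSec P k U) (x : ((Opens.map f).op.obj U).unop) :
    (sectionMap φ k U s).val x = stalkMap φ k x.1 (s.val ⟨f x.1, x.2⟩) := rfl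

/-- Equality is tested in each stalk, where both summands have representatives over a common
neighbourhood `W` of `f x`; there it is additivity of `φ_W`. The lemmas for the product and the
differential follow the same pattern. -/
theorem sectionMap_add (φ : P ⟶ (Opens.map f).op ⋙ Q) {k : ℕ} {U : (Opens Y)ᵒᵖ}
    (s t : ShSec P k U) : sectionMap φ k U (s + t) = sectionMap φ k U s + sectionMap φ k U t :=
  ShSec.ext fun x => by
    obtain ⟨W, i, hW, a, b, -, ha, hb, -⟩ := exists_dgerm (P := P) (V := U.unop) (x := f x.1) x.2
      (s.val ⟨f x.1, x.2⟩) (t.val ⟨f x.1, x.2⟩) (t.val ⟨f x.1, x.2⟩)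
    rw [add_val, sectionMap_val, sectionMap_val, sectionMap_val, add_val, ha, hb, add_germ,
      stalkMap_dgerm, stalkMap_dgerm, stalkMap_dgerm, map_add]
    -- What is left is addition of germs of `Q` over `f⁻¹ W`. The values of `φ` are typed in `(f_*
    -- Q)(W)`, which equals `Q(f⁻¹ W)` by definition, hence the explicit arguments.
    exact (add_germ (P := Q) (W := (Opens.map f).obj W) hW _ _).symm

/-- Unlike the other operations, this one mixes a germ with a scalar living over all of `U`, so
naturality of `φ` on rings is needed to pass to a smaller `W`. The image of `c` appears as a
separate `c'`, typed in the ring of `Q` over `f⁻¹ U`, so that the scalar action on sections of the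
sheafification of `Q` applies to it. -/
theorem sectionMap_smul (φ : P ⟶ (Opens.map f).op ⋙ Q) {k : ℕ} {U : (Opens Y)ᵒᵖ}
    (c : (P.obj U).ring) (c' : (Q.obj ((Opens.map f).op.obj U)).ring)
    (hc : (φ.app U).ringHom.toFun c = c') (s : ShSec P k U) :
    sectionMap φ k U (c • s) = c' • sectionMap φ k U s :=
  ShSec.ext fun x => by
    obtain ⟨W, i, hW, a, -, -, ha, -, -⟩ := exists_dgerm (P := P) (V := U.unop) (x := f x.1) x.2
      (s.val ⟨f x.1, x.2⟩) (s.val ⟨f x.1, x.2⟩) (s.val ⟨f x.1, x.2⟩)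
    -- Restricting `c` to `W` and then applying `φ_W` agrees with applying `φ_U` and then
    -- restricting to `f⁻¹ W`.
    have hnat : (φ.app (op W)).ringHom.toFun ((P.map i.op).ringHom.toFun c)
        = (Q.map ((Opens.map f).map i).op).ringHom.toFun c' :=
      (congrArg (fun F => F.ringHom.toFun c) (φ.naturality i.op)).trans
        (congrArg (Q.map ((Opens.map f).map i).op).ringHom.toFun hc)
    rw [sectionMap_val, smul_val _ _ _ i hW, smul_val _ _ x ((Opens.map f).map i) hW,
      sectionMap_val, ha, smul_germ, stalkMap_dgerm, stalkMap_dgerm,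
      (φ.app (op W)).map_smul]
    refine Eq.trans ?_ (smul_germ (P := Q) (W := (Opens.map f).obj W) hW _ _).symm
    -- Both sides are now germs of multiples of the same element `b`; only the scalars differ, and
    -- `hnat` identifies them.
    let b : (Q.obj (op ((Opens.map f).obj W))).cdga.obj k := (φ.app (op W)).map k a
    exact congrArg (fun r : (Q.obj (op ((Opens.map f).obj W))).ring =>
      dgerm (W := (Opens.map f).obj W) hW (r • b)) hnat

theorem sectionMap_wedge (φ : P ⟶ (Opens.map f).op ⋙ Q) {k l m : ℕ} (h : k + l = m)
    {U : (Opens Y)ᵒᵖ} (s : ShSec P k U) (t : ShSec P l U) :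
    sectionMap φ m U (shWedge h s t) = shWedge h (sectionMap φ k U s) (sectionMap φ l U t) :=
  ShSec.ext fun x => by
    obtain ⟨W, i, hW, a, b, -, ha, hb, -⟩ := exists_dgerm (P := P) (V := U.unop) (x := f x.1) x.2
      (s.val ⟨f x.1, x.2⟩) (t.val ⟨f x.1, x.2⟩) (t.val ⟨f x.1, x.2⟩)
    rw [shWedge_val, sectionMap_val, sectionMap_val, sectionMap_val, shWedge_val, ha, hb,
      wedge_germ, stalkMap_dgerm, stalkMap_dgerm, stalkMap_dgerm,
      (φ.app (op W)).map_wedge]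
    exact (wedge_germ (P := Q) (W := (Opens.map f).obj W) hW h _ _).symm

theorem sectionMap_d (φ : P ⟶ (Opens.map f).op ⋙ Q) {k : ℕ} {U : (Opens Y)ᵒᵖ}
    (s : ShSec P k U) : sectionMap φ (k + 1) U (shD k s) = shD k (sectionMap φ k U s) :=
  ShSec.ext fun x => by
    obtain ⟨W, i, hW, a, -, -, ha, -, -⟩ := exists_dgerm (P := P) (V := U.unop) (x := f x.1) x.2
      (s.val ⟨f x.1, x.2⟩) (s.val ⟨f x.1, x.2⟩) (s.val ⟨f x.1, x.2⟩)
    rw [shD_val, sectionMap_val, sectionMap_val, shD_val, ha, d_germ, stalkMap_dgerm,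
      stalkMap_dgerm, (φ.app (op W)).map_d]
    exact (d_germ (P := Q) (W := (Opens.map f).obj W) hW _).symm

/-! ### The induced morphism of sheafifications and its uniqueness. -/

/-- The morphism of sheafifications induced by a morphism `P ⟶ f_* Q`. -/
noncomputable def sheafifyMap (φ : P ⟶ (Opens.map f).op ⋙ Q) :
    sheafify P ⟶ (Opens.map f).op ⋙ sheafify Q where
  app U :=
    { ringHom := (φ.app U).ringHom
      -- Between groups additivity already forces zero to go to zero.
      map := fun k => AddMonoidHom.mk' (sectionMap φ k U) (sectionMap_add φ)
      map_smul := fun c s => sectionMap_smul φ c _ rfl s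
      map_wedge := fun h s t => sectionMap_wedge φ h s t
      map_d := fun s => sectionMap_d φ s }
  -- On rings this is naturality of `φ`. In each degree it holds by definition, since restriction
  -- only forgets values and `sectionMap` acts on each value separately.
  naturality _ _ i := CDGACat.Hom.ext (toRing.congr_map (φ.naturality i)) rfl

theorem toSheafify_sheafifyMap (φ : P ⟶ (Opens.map f).op ⋙ Q) :
    toSheafify P ≫ sheafifyMap φ = φ ≫ Functor.whiskerLeft (Opens.map f).op (toSheafify Q) :=
  NatTrans.ext <| funext fun U => CDGACat.Hom.ext rfl <| funext fun k => AddMonoidHom.ext fun a =>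
    ShSec.ext (P := Q) (k := k) fun x => stalkMap_dgerm (W := U.unop) φ x.2 a

/-- Morphisms out of a sheafification into a pushforward of a sheafification are determined by
their composition with the canonical morphism. -/
theorem sheafify_hom_ext {F G : sheafify P ⟶ (Opens.map f).op ⋙ sheafify Q}
    (h : toSheafify P ≫ F = toSheafify P ≫ G) : F = G := by
  refine NatTrans.ext <| funext fun U => CDGACat.Hom.ext ?_ <| funext fun k =>
    AddMonoidHom.ext fun s => ShSec.ext (P := Q) (k := k) fun x => ?_
  -- The ring component of `toSheafify P` is the identity, so composing with it does not change the
  -- ring component.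
  · exact congrArg (fun T : P ⟶ (Opens.map f).op ⋙ sheafify Q => (T.app U).ringHom) h
  -- Near `f x` the section `s` is the family of germs of an element `g ∈ P(V)`, so its restriction
  -- to `V` is the image of `g` under the canonical map.
  · obtain ⟨V, hV, i, g, hg⟩ := Subtype.property (p := _) s ⟨f x.1, x.2⟩
    have hs : ((sheafify P).map i.op).map k s = ((toSheafify P).app (op V)).map k g :=
      ShSec.ext (P := P) (k := k) hg
    -- Restricting `T(s)` to `f⁻¹ V` keeps its value at `x`, and by naturality that restriction is
    -- `T(s|_V)`. So the value depends on `T` only through `toSheafify P ≫ T`; this is applied to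
    -- both `F` and `G`.
    have hval : ∀ T : sheafify P ⟶ (Opens.map f).op ⋙ sheafify Q,
        ShSec.val (P := Q) (k := k) ((T.app U).map k s) x
          = ShSec.val (P := Q) (k := k)
            (((toSheafify P ≫ T).app (op V)).map k g) ⟨x.1, hV⟩ := by
      intro T
      have hT : (T.app (op V)).map k (((sheafify P).map i.op).map k s)
          = ((sheafify Q).map ((Opens.map f).map i).op).map k ((T.app U).map k s) :=
        congrArg (fun H => CDGACat.Hom.map H k s) (T.naturality i.op)
      rw [hs] at hT
      exact (congrArg (fun t => ShSec.val (P := Q) (k := k) t ⟨x.1, hV⟩) hT).symm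
    rw [hval F, hval G, h]

end Pushforward

end CDGACat

theorem theorem8p13 {M N : CInftyRingedSpace.{u}} (f : M.Hom N) :
    ∃! F : N.formsSheaf ⟶ SheafOfCDGA.pushforward f.base M.formsSheaf,
      (∀ U : (Opens N.carrier)ᵒᵖ, (F.app U).ringHom = f.sharp.app U) ∧
      N.toFormsSheaf ≫ F
        = f.presheafPullback ≫ Functor.whiskerLeft (Opens.map f.base).op M.toFormsSheaf := by
  -- The ring component of `sheafifyMap φ` is that of `φ`, and for `presheafPullback` this is `f_#`
  -- by definition.
  refine ⟨CDGACat.sheafifyMap f.presheafPullback,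
    ⟨fun _ => rfl, CDGACat.toSheafify_sheafifyMap f.presheafPullback⟩, fun G hG => ?_⟩
  exact CDGACat.sheafify_hom_ext
    (hG.2.trans (CDGACat.toSheafify_sheafifyMap f.presheafPullback).symm)
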